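/- Let $P$ and $Q$ be monotone lattice paths (unit north and east steps) from $(0,0)$ to $(m,r)$ such that $P$ never goes above $Q$, i.e. there are no points $(p_1,p_2)$ of $P$ and $(q_1,q_2)$ of $Q$ with $p_1<q_1$ and $p_2>q_2$. Put $n=m+r$. Let $M[P,Q]$ be the matroid on the $n$ step positions $1,\dots,n$ whose bases are the sets of positions of the north steps of the monotone paths from $(0,0)$ to $(m,r)$ that stay in the region bounded by $P$ and $Q$; a lattice path matroid is a matroid isomorphic to some $M[P,Q]$. The Tutte polynomial of a matroid with finite ground set $E$ and rank function $\rho$ is $\sum_{A\subseteq E}(x-1)^{\rho(E)-\rho(A)}(y-1)^{|A|-\rho(A)}$. The lattice of $P,Q$ has as vertices the integer points between $P$ and $Q$ and as edges the unit steps between them; north steps of $Q$ have weight $x$, east steps of $P$ have weight $y$, all other edges have weight $1$. For a vertex $v$, the matrix $M_v$ has one row for each incoming edge (from the left, from below) and one column for each outgoing edge (up, right), and each column is filled with the weight of its edge; exceptionally, $M_{(0,0)}$ has one row, and $M_{(m,r)}$ has one column, with all entries $1$. Consider the following algorithm. The input consists of $P$ and $Q$, given by the numbers $P[i,1],P[i,2]$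 and $Q[i,1],Q[i,2]$ of east and north steps among the first $i$ steps, $0\le i\le n$. Start with the row vector $T=(1)$. For $i=0,\dots,n$: form the list $A$ of the matrices $M_v$ of the vertices $v=(Q[i,1]+j,\,Q[i,2]-j)$, $j=0,\dots,Q[i,2]-P[i,2]$; split $T=(T_1,\dots,T_\ell)$ into blocks of lengths equal to the numbers of rows of $A[1],\dots,A[\ell]$; and replace $T$ by $(T_1A[1],\dots,T_\ell A[\ell])$. Return the first entry of $T$. **Theorem.** (1) If $x$ and $y$ are indeterminates, and polynomials are represented by their arrays of integer coefficients and added and multiplied by $1$, $x$, $y$ coefficient by coefficient, then the algorithm returns the Tutte polynomial of $M[P,Q]$, and hence of every matroid isomorphic to it, and for $n\ge 1$ it runs in time $O(n^4)$, where each operation on an integer coefficient or an index counts as one step. (2) If $x$ and $y$ are fixed elements of a commutative ring, then the algorithm returns the value of this Tutte polynomial at $(x,y)$, and for $n\ge 1$ it uses $O(n^2)$ arithmetic operations; this bound includes all index operations, comparisons, memory accesses and loop control. The implied constants are absolute. -/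

import Mathlib

namespace LatticeTutte

/-! ## Lattice paths -/

/-- A monotone lattice path from `(0,0)` to `(m,r)`: a sequence of `m + r` unit steps, recorded by
the set of the positions of its `r` north steps; the other `m` steps are east steps. (Positions
are numbered from `0`.) -/
structure LatticePath (m r : ℕ) where
  north : Finset (Fin (m + r))
  card_north : north.card = r

namespace LatticePath

variable {m r : ℕ}

/-- The number of north steps among the first `i` steps. -/
def norths (C : LatticePath m r) (i : ℕ) : ℕ :=
  (Finset.univ.filter fun k : Fin (m + r) => k ∈ C.north ∧ k.val < i).card

/-- The number of east steps among the first `i` steps. -/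
def easts (C : LatticePath m r) (i : ℕ) : ℕ :=
  (Finset.univ.filter fun k : Fin (m + r) => k ∉ C.north ∧ k.val < i).card

/-- `P` never goes above `Q`: there are no points `(p₁,p₂)` of `P` and `(q₁,q₂)` of `Q` with
`p₁ < q₁` and `q₂ < p₂`. -/
def NeverAbove (P Q : LatticePath m r) : Prop :=
  ∀ i ≤ m + r, ∀ j ≤ m + r, ¬ (P.easts i < Q.easts j ∧ Q.norths j < P.norths i)

theorem card_lt (n i : ℕ) (hi : i ≤ n) :
    (Finset.univ.filter fun k : Fin n => k.val < i).card = i := by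
  have h : (Finset.univ.filter fun k : Fin n => k.val < i).map Fin.valEmbedding
      = Finset.range i := by
    ext k
    simp only [Finset.mem_map, Finset.mem_filter, Finset.mem_univ, true_and,
      Fin.valEmbedding_apply, Finset.mem_range]
    constructor
    · rintro ⟨a, ha, rfl⟩; exact ha
    · intro hk; exact ⟨⟨k, by omega⟩, hk, rfl⟩
  rw [← Finset.card_map, h, Finset.card_range]

theorem easts_add_norths (C : LatticePath m r) {i : ℕ} (hi : i ≤ m + r) :
    C.easts i + C.norths i = i := by
  conv_rhs => rw [← card_lt (m + r) i hi]
  rw [← Finset.card_filter_add_card_filter_not (s := Finset.univ.filter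
    fun k : Fin (m + r) => k.val < i) (fun k => k ∉ C.north), Finset.filter_filter,
    Finset.filter_filter]
  simp only [easts, norths, not_not, and_comm]

/-- The number of elements of `S` among the first `i` positions. -/
def prefixCount {n : ℕ} (S : Finset (Fin n)) (i : ℕ) : ℕ :=
  (Finset.univ.filter fun k : Fin n => k ∈ S ∧ k.val < i).card

theorem norths_eq (C : LatticePath m r) (i : ℕ) : C.norths i = prefixCount C.north i := rfl

theorem norths_mono (C : LatticePath m r) {i j : ℕ} (h : i ≤ j) : C.norths i ≤ C.norths j := by
  apply Finset.card_le_card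
  intro k
  simp only [Finset.mem_filter, Finset.mem_univ, true_and]
  exact fun hk => ⟨hk.1, by omega⟩

theorem easts_mono (C : LatticePath m r) {i j : ℕ} (h : i ≤ j) : C.easts i ≤ C.easts j := by
  apply Finset.card_le_card
  intro k
  simp only [Finset.mem_filter, Finset.mem_univ, true_and]
  exact fun hk => ⟨hk.1, by omega⟩

theorem neverAbove_iff (P Q : LatticePath m r) :
    NeverAbove P Q ↔ ∀ i ≤ m + r, P.norths i ≤ Q.norths i := by
  constructor
  · intro h i hi
    by_contra hc
    have h1 := P.easts_add_norths hi
    have h2 := Q.easts_add_norths hi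
    exact h i hi i hi ⟨by omega, by omega⟩
  · rintro h i hi j hj ⟨h1, h2⟩
    rcases le_total i j with hij | hij
    · have := h i hi
      have := Q.norths_mono hij
      omega
    · have := h i hi
      have := P.easts_add_norths hi
      have := Q.easts_add_norths hi
      have := Q.easts_mono hij
      omega

theorem prefixCount_zero {n : ℕ} (S : Finset (Fin n)) : prefixCount S 0 = 0 := by
  simp [prefixCount]

theorem prefixCount_top {n : ℕ} (S : Finset (Fin n)) : prefixCount S n = S.card := by
  simp [prefixCount]

theorem prefixCount_succ {n : ℕ} (S : Finset (Fin n)) (k : Fin n) :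
    prefixCount S (k.val + 1) = prefixCount S k.val + if k ∈ S then 1 else 0 := by
  have h : (Finset.univ.filter fun l : Fin n => l ∈ S ∧ l.val < k.val + 1)
      = (Finset.univ.filter fun l : Fin n => l ∈ S ∧ l.val < k.val) ∪
        (if k ∈ S then {k} else ∅) := by
    ext l
    by_cases hk : k ∈ S
    · simp only [Finset.mem_filter, Finset.mem_univ, true_and, if_pos hk, Finset.mem_union,
        Finset.mem_singleton]
      constructor
      · rintro ⟨h1, h2⟩
        by_cases hl : l = k
        · exact Or.inr hl
        · exact Or.inl ⟨h1, by have := fun e => hl (Fin.ext e); omega⟩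
      · rintro (⟨h1, h2⟩ | rfl)
        · exact ⟨h1, by omega⟩
        · exact ⟨hk, by omega⟩
    · simp only [Finset.mem_filter, Finset.mem_univ, true_and, if_neg hk, Finset.union_empty]
      constructor
      · rintro ⟨h1, h2⟩
        refine ⟨h1, ?_⟩
        have : l ≠ k := fun e => hk (e ▸ h1)
        have := fun e => this (Fin.ext e)
        omega
      · rintro ⟨h1, h2⟩
        exact ⟨h1, by omega⟩
  unfold prefixCount
  rw [h, Finset.card_union_of_disjoint]
  · split_ifs <;> simp
  · split_ifs <;> simp

theorem prefixCount_exchange {n : ℕ} (S : Finset (Fin n)) (x y : Fin n) (hx : x ∈ S)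
    (hy : y ∉ S) (i : ℕ) :
    prefixCount (insert y (S.erase x)) i + (if x.val < i then 1 else 0)
      = prefixCount S i + (if y.val < i then 1 else 0) := by
  have hxy : x ≠ y := fun e => hy (e ▸ hx)
  have key : ∀ i ≤ n, prefixCount (insert y (S.erase x)) i + (if x.val < i then 1 else 0)
      = prefixCount S i + (if y.val < i then 1 else 0) := by
    intro i
    induction i with
    | zero => intro _; simp [prefixCount_zero]
    | succ i ih =>
      intro hi
      have h0 := ih (by omega)
      have e1 := prefixCount_succ (insert y (S.erase x)) ⟨i, by omega⟩
      have e2 := prefixCount_succ S ⟨i, by omega⟩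
      simp only at e1 e2
      rw [e1, e2]
      rcases lt_trichotomy x.val i with h | h | h
      · rcases lt_trichotomy y.val i with h' | h' | h'
        · have n1 : (⟨i, by omega⟩ : Fin n) ≠ x := fun e => by simp [← e] at h
          have n2 : (⟨i, by omega⟩ : Fin n) ≠ y := fun e => by simp [← e] at h'
          simp only [Finset.mem_insert, Finset.mem_erase, n1, n2, ne_eq, not_false_iff, true_and,
            false_or]
          split_ifs at * <;> omega
        · have n2 : (⟨i, by omega⟩ : Fin n) = y := Fin.ext h'.symm
          rw [n2, if_pos (Finset.mem_insert_self _ _), if_neg hy]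
          split_ifs at * <;> omega
        · have n1 : (⟨i, by omega⟩ : Fin n) ≠ x := fun e => by simp [← e] at h
          have n2 : (⟨i, by omega⟩ : Fin n) ≠ y := fun e => by simp [← e] at h'
          simp only [Finset.mem_insert, Finset.mem_erase, n1, n2, ne_eq, not_false_iff, true_and,
            false_or]
          split_ifs at * <;> omega
      · have n1 : (⟨i, by omega⟩ : Fin n) = x := Fin.ext h.symm
        have n3 : x ∉ insert y (S.erase x) := by simp [hxy]
        have n4 : y.val ≠ i := fun e => hxy (Fin.ext (by omega))
        rw [n1, if_neg n3, if_pos hx]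
        split_ifs at * <;> omega
      · rcases lt_trichotomy y.val i with h' | h' | h'
        · have n1 : (⟨i, by omega⟩ : Fin n) ≠ x := fun e => by simp [← e] at h
          have n2 : (⟨i, by omega⟩ : Fin n) ≠ y := fun e => by simp [← e] at h'
          simp only [Finset.mem_insert, Finset.mem_erase, n1, n2, ne_eq, not_false_iff, true_and,
            false_or]
          split_ifs at * <;> omega
        · have n2 : (⟨i, by omega⟩ : Fin n) = y := Fin.ext h'.symm
          rw [n2, if_pos (Finset.mem_insert_self _ _), if_neg hy]
          split_ifs at * <;> omega
        · have n1 : (⟨i, by omega⟩ : Fin n) ≠ x := fun e => by simp [← e] at h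
          have n2 : (⟨i, by omega⟩ : Fin n) ≠ y := fun e => by simp [← e] at h'
          simp only [Finset.mem_insert, Finset.mem_erase, n1, n2, ne_eq, not_false_iff, true_and,
            false_or]
          split_ifs at * <;> omega
  rcases le_total i n with h | h
  · exact key i h
  · have hle : ∀ T : Finset (Fin n), prefixCount T i = prefixCount T n := by
      intro T
      unfold prefixCount
      congr 1
      ext l
      have := l.isLt
      simp only [Finset.mem_filter, Finset.mem_univ, true_and]
      constructor
      · exact fun h => ⟨h.1, by omega⟩
      · exact fun h => ⟨h.1, by omega⟩
    have := key n le_rfl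
    rw [hle, hle]
    have h1 := x.isLt
    have h2 := y.isLt
    split_ifs at * <;> omega

end LatticePath

open LatticePath

/-- `B` is the set of positions of the north steps of a full path of the region bounded by `P` and
`Q`, i.e. of a monotone path from `(0,0)` to `(m,r)` that stays between `P` and `Q`. -/
def IsFullPathSet {m r : ℕ} (P Q : LatticePath m r) (B : Set (Fin (m + r))) : Prop :=
  ∃ C : LatticePath m r, (C.north : Set (Fin (m + r))) = B ∧ NeverAbove P C ∧ NeverAbove C Q

theorem exchange_exists {m r : ℕ} (P Q A B : LatticePath m r) (hPA : NeverAbove P A)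
    (hAQ : NeverAbove A Q) (hPB : NeverAbove P B) (hBQ : NeverAbove B Q)
    (x : Fin (m + r)) (hxA : x ∈ A.north) (hxB : x ∉ B.north) :
    ∃ y, y ∈ B.north ∧ y ∉ A.north ∧
      ∀ i ≤ m + r, P.norths i ≤ prefixCount (insert y (A.north.erase x)) i ∧
        prefixCount (insert y (A.north.erase x)) i ≤ Q.norths i := by
  rw [neverAbove_iff] at hPA hAQ hPB hBQ
  have sA := fun k => prefixCount_succ A.north k
  have sB := fun k => prefixCount_succ B.north k
  simp only [norths_eq] at *
  have hx1 := sA x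
  have hx2 := sB x
  rw [if_pos hxA] at hx1
  rw [if_neg hxB] at hx2
  have tA : prefixCount A.north (m + r) = r := by rw [prefixCount_top, A.card_north]
  have tB : prefixCount B.north (m + r) = r := by rw [prefixCount_top, B.card_north]
  by_cases hd : prefixCount B.north (x.val + 1) < prefixCount A.north (x.val + 1)
  · -- look to the right of `x`
    have hex : ∃ j, x.val + 1 < j ∧ j ≤ m + r ∧
        prefixCount A.north j ≤ prefixCount B.north j := by
      refine ⟨m + r, ?_, le_rfl, by omega⟩
      by_contra hc
      have : x.val + 1 = m + r := by have := x.isLt; omega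
      rw [this] at hd
      omega
    classical
    obtain ⟨h1, h2, h3⟩ := Nat.find_spec hex
    set j := Nat.find hex with hj
    have hmin : ∀ i, x.val + 1 ≤ i → i < j → prefixCount B.north i < prefixCount A.north i := by
      intro i hi hij
      rcases Nat.lt_or_ge (x.val + 1) i with h | h
      · have := Nat.find_min hex hij
        by_contra hc
        exact this ⟨h, by omega, by omega⟩
      · have : i = x.val + 1 := by omega
        rw [this]; exact hd
    have hlast := hmin (j - 1) (by omega) (by omega)
    have hA := sA ⟨j - 1, by omega⟩
    have hB := sB ⟨j - 1, by omega⟩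
    simp only [show j - 1 + 1 = j by omega] at hA hB
    have hyB : (⟨j - 1, by omega⟩ : Fin (m + r)) ∈ B.north := by
      by_contra hc
      rw [if_neg hc] at hB
      omega
    have hyA : (⟨j - 1, by omega⟩ : Fin (m + r)) ∉ A.north := by
      intro hc
      rw [if_pos hc] at hA
      rw [if_pos hyB] at hB
      omega
    refine ⟨⟨j - 1, by omega⟩, hyB, hyA, fun i hi => ?_⟩
    have e := prefixCount_exchange A.north x ⟨j - 1, by omega⟩ hxA hyA i
    have p1 := hPA i hi
    have p2 := hAQ i hi
    have p3 := hPB i hi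
    have p4 := hBQ i hi
    have p5 := hmin i
    simp only at e
    split_ifs at e <;> exact ⟨by omega, by omega⟩
  · -- look to the left of `x`
    have hd' : prefixCount A.north x.val < prefixCount B.north x.val := by omega
    have hP0 : prefixCount A.north 0 = 0 := prefixCount_zero _
    have hQ0 : prefixCount B.north 0 = 0 := prefixCount_zero _
    have hex : ∃ d, d ≤ x.val ∧
        prefixCount B.north (x.val - d) ≤ prefixCount A.north (x.val - d) :=
      ⟨x.val, le_rfl, by simp [hP0, hQ0]⟩
    classical
    obtain ⟨h1, h2⟩ := Nat.find_spec hex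
    set d := Nat.find hex with hdd
    have hd0 : d ≠ 0 := by
      intro h0
      rw [h0] at h2
      simp only [Nat.sub_zero] at h2
      omega
    have hmin : ∀ i, x.val - d < i → i ≤ x.val →
        prefixCount A.north i < prefixCount B.north i := by
      intro i hi hix
      have := Nat.find_min hex (m := x.val - i) (by omega)
      by_contra hc
      refine this ⟨by omega, ?_⟩
      rw [show x.val - (x.val - i) = i by omega]
      omega
    have hxlt := x.isLt
    have hfirst := hmin (x.val - d + 1) (by omega) (by omega)
    have hA := sA ⟨x.val - d, by omega⟩
    have hB := sB ⟨x.val - d, by omega⟩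
    simp only at hA hB
    have hyB : (⟨x.val - d, by omega⟩ : Fin (m + r)) ∈ B.north := by
      by_contra hc
      rw [if_neg hc] at hB
      omega
    have hyA : (⟨x.val - d, by omega⟩ : Fin (m + r)) ∉ A.north := by
      intro hc
      rw [if_pos hc] at hA
      rw [if_pos hyB] at hB
      omega
    refine ⟨⟨x.val - d, by omega⟩, hyB, hyA, fun i hi => ?_⟩
    have e := prefixCount_exchange A.north x ⟨x.val - d, by omega⟩ hxA hyA i
    have p1 := hPA i hi
    have p2 := hAQ i hi
    have p3 := hPB i hi
    have p4 := hBQ i hi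
    have p5 := hmin i
    simp only at e
    split_ifs at e <;> exact ⟨by omega, by omega⟩

theorem isFullPathSet_exchange {m r : ℕ} (P Q : LatticePath m r) :
    Matroid.ExchangeProperty (IsFullPathSet P Q) := by
  rintro X Y ⟨A, rfl, hPA, hAQ⟩ ⟨B, rfl, hPB, hBQ⟩ x ⟨hxA, hxB⟩
  simp only [Finset.mem_coe] at hxA hxB
  obtain ⟨y, hyB, hyA, h⟩ := exchange_exists P Q A B hPA hAQ hPB hBQ x hxA hxB
  have hxy : y ∉ A.north.erase x := fun hc => hyA (Finset.mem_of_mem_erase hc)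
  have hcard : (insert y (A.north.erase x)).card = r := by
    have := Finset.card_pos.mpr ⟨x, hxA⟩
    rw [Finset.card_insert_of_notMem hxy, Finset.card_erase_of_mem hxA, A.card_north]
    rw [A.card_north] at this
    omega
  refine ⟨y, ⟨by simpa using hyB, by simpa using hyA⟩,
    ⟨⟨insert y (A.north.erase x), hcard⟩, by simp, ?_, ?_⟩⟩
  · rw [neverAbove_iff]
    exact fun i hi => (h i hi).1
  · rw [neverAbove_iff]
    exact fun i hi => (h i hi).2

/-- The lattice path matroid `M[P,Q]`: its ground set is the set of the `m + r` positions and its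
bases are the sets that represent full paths of the region bounded by `P` and `Q`. -/
def latticePathMatroid {m r : ℕ} (P Q : LatticePath m r) (h : NeverAbove P Q) :
    Matroid (Fin (m + r)) :=
  Matroid.ofIsBaseOfFinite (E := Set.univ) Set.finite_univ (IsFullPathSet P Q)
    ⟨Q.north, Q, rfl, h, (neverAbove_iff Q Q).2 fun _ _ => le_rfl⟩
    (isFullPathSet_exchange P Q) (fun _ _ => Set.subset_univ _)

/-- `N` is isomorphic to `M[P,Q]`, i.e. it is the image of `M[P,Q]` under a relabelling of the
elements. -/
def IsIsomorphicTo {m r : ℕ} {α : Type*} (N : Matroid α) (P Q : LatticePath m r)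
    (h : NeverAbove P Q) : Prop :=
  ∃ f : Fin (m + r) ↪ α, N = (latticePathMatroid P Q h).mapEmbedding f

/-- The rank of a subset of a matroid on a finite ground set. -/
noncomputable def rank {α : Type*} (M : Matroid α) (A : Set α) : ℕ := (M.eRk A).toNat

/-- The Tutte polynomial of a matroid `M` with finite ground set `E`:
`∑_{A ⊆ E} (x - 1)^(r(E) - r(A)) (y - 1)^(|A| - r(A))`, with `x = X 0` and `y = X 1`. -/
noncomputable def tuttePolynomial {α : Type*} (M : Matroid α) : MvPolynomial (Fin 2) ℤ :=
  ∑ᶠ A ∈ 𝒫 M.E, (MvPolynomial.X 0 - 1) ^ (rank M M.E - rank M A) *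
    (MvPolynomial.X 1 - 1) ^ (A.ncard - rank M A)

/-! ## The machine

A unit-cost random access machine with two sorts of memory: registers and arrays of natural
numbers (counters, addresses, table entries), and arrays of data in a commutative ring `R`. The
names of the registers, of the number arrays and of the data arrays are the elements of the types
`V`, `A`, `D`. Every arithmetic operation, comparison, memory access, assignment, branch and loop
iteration takes one step, on both sorts. -/

/-- Expressions for natural numbers (`sub` is truncated subtraction). -/
inductive NExp (V A : Type) where
  | lit (k : ℕ)
  | reg (v : V)
  | get (a : A) (e : NExp V A)
  | add (e₁ e₂ : NExp V A)
  | sub (e₁ e₂ : NExp V A)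
  | mul (e₁ e₂ : NExp V A)

/-- Tests. -/
inductive BExp (V A : Type) where
  | eq (e₁ e₂ : NExp V A)
  | le (e₁ e₂ : NExp V A)
  | and (b₁ b₂ : BExp V A)

/-- Expressions for data. -/
inductive DExp (V A D : Type) where
  | zero
  | one
  | get (d : D) (e : NExp V A)
  | add (t₁ t₂ : DExp V A D)
  | mul (t₁ t₂ : DExp V A D)

/-- Programs. -/
inductive Stmt (V A D : Type) where
  /-- do nothing -/
  | skip
  /-- `v ← e` -/
  | setReg (v : V) (e : NExp V A)
  /-- `a[e₁] ← e₂` -/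
  | setArr (a : A) (e₁ e₂ : NExp V A)
  /-- `d[e] ← t` -/
  | setData (d : D) (e : NExp V A) (t : DExp V A D)
  /-- `s₁; s₂` -/
  | seq (s₁ s₂ : Stmt V A D)
  /-- `if b then s₁ else s₂` -/
  | ite (b : BExp V A) (s₁ s₂ : Stmt V A D)
  /-- `for v from 0 to e - 1 do s`; the bound `e` is evaluated once, on entry -/
  | loop (v : V) (e : NExp V A) (s : Stmt V A D)

/-- The contents of the memory. -/
structure Store (V A D R : Type*) where
  reg : V → ℕ
  arr : A → ℕ → ℕ
  data : D → ℕ → R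

section Semantics

variable {V A D : Type}

instance : Add (NExp V A) := ⟨NExp.add⟩
instance : Sub (NExp V A) := ⟨NExp.sub⟩
instance : Mul (NExp V A) := ⟨NExp.mul⟩
instance (k : ℕ) : OfNat (NExp V A) k := ⟨NExp.lit k⟩
instance : Coe V (NExp V A) := ⟨NExp.reg⟩

/-- The value of an expression. -/
def NExp.eval {R : Type*} (σ : Store V A D R) : NExp V A → ℕ
  | .lit k => k
  | .reg v => σ.reg v
  | .get a e => σ.arr a (e.eval σ)
  | .add e₁ e₂ => e₁.eval σ + e₂.eval σ
  | .sub e₁ e₂ => e₁.eval σ - e₂.eval σ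
  | .mul e₁ e₂ => e₁.eval σ * e₂.eval σ

/-- The number of steps that the evaluation of an expression takes. -/
def NExp.cost : NExp V A → ℕ
  | .lit _ => 1
  | .reg _ => 1
  | .get _ e => e.cost + 1
  | .add e₁ e₂ => e₁.cost + e₂.cost + 1
  | .sub e₁ e₂ => e₁.cost + e₂.cost + 1
  | .mul e₁ e₂ => e₁.cost + e₂.cost + 1

/-- The outcome of a test. -/
def BExp.eval {R : Type*} (σ : Store V A D R) : BExp V A → Bool
  | .eq e₁ e₂ => decide (e₁.eval σ = e₂.eval σ)
  | .le e₁ e₂ => decide (e₁.eval σ ≤ e₂.eval σ)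
  | .and b₁ b₂ => b₁.eval σ && b₂.eval σ

/-- The number of steps that a test takes. -/
def BExp.cost : BExp V A → ℕ
  | .eq e₁ e₂ => e₁.cost + e₂.cost + 1
  | .le e₁ e₂ => e₁.cost + e₂.cost + 1
  | .and b₁ b₂ => b₁.cost + b₂.cost + 1

/-- The value of a data expression. -/
def DExp.eval {R : Type*} [CommRing R] (σ : Store V A D R) : DExp V A D → R
  | .zero => 0
  | .one => 1
  | .get d e => σ.data d (e.eval σ)
  | .add t₁ t₂ => t₁.eval σ + t₂.eval σ
  | .mul t₁ t₂ => t₁.eval σ * t₂.eval σ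

/-- The number of steps that the evaluation of a data expression takes. -/
def DExp.cost : DExp V A D → ℕ
  | .zero => 1
  | .one => 1
  | .get _ e => e.cost + 1
  | .add t₁ t₂ => t₁.cost + t₂.cost + 1
  | .mul t₁ t₂ => t₁.cost + t₂.cost + 1

variable [DecidableEq V] [DecidableEq A] [DecidableEq D]

/-- The memory after `v ← k`. -/
def Store.setReg {R : Type*} (σ : Store V A D R) (v : V) (k : ℕ) : Store V A D R :=
  { σ with reg := Function.update σ.reg v k }

/-- The memory after `a[i] ← k`. -/
def Store.setArr {R : Type*} (σ : Store V A D R) (a : A) (i k : ℕ) : Store V A D R :=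
  { σ with arr := Function.update σ.arr a (Function.update (σ.arr a) i k) }

/-- The memory after `d[i] ← z`. -/
def Store.setData {R : Type*} (σ : Store V A D R) (d : D) (i : ℕ) (z : R) : Store V A D R :=
  { σ with data := Function.update σ.data d (Function.update (σ.data d) i z) }

/-- The memory after `k` iterations of a loop with counter `v` whose body acts as `body`. -/
def iterate {R : Type*} (v : V) (body : Store V A D R → Store V A D R) (σ : Store V A D R) :
    ℕ → Store V A D R
  | 0 => σ
  | k + 1 => body ((iterate v body σ k).setReg v k)

/-- The memory after the execution of a program. -/
def Stmt.run {R : Type*} [CommRing R] : Stmt V A D → Store V A D R → Store V A D R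
  | .skip, σ => σ
  | .setReg v e, σ => σ.setReg v (e.eval σ)
  | .setArr a e₁ e₂, σ => σ.setArr a (e₁.eval σ) (e₂.eval σ)
  | .setData d e t, σ => σ.setData d (e.eval σ) (t.eval σ)
  | .seq s₁ s₂, σ => s₂.run (s₁.run σ)
  | .ite b s₁ s₂, σ => if b.eval σ then s₁.run σ else s₂.run σ
  | .loop v e s, σ => iterate v s.run σ (e.eval σ)

/-- The number of steps that the execution of a program takes. -/
def Stmt.cost {R : Type*} [CommRing R] : Stmt V A D → Store V A D R → ℕ
  | .skip, _ => 1
  | .setReg _ e, _ => e.cost + 1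
  | .setArr _ e₁ e₂, _ => e₁.cost + e₂.cost + 1
  | .setData _ e t, _ => e.cost + t.cost + 1
  | .seq s₁ s₂, σ => s₁.cost σ + s₂.cost (s₁.run σ)
  | .ite b s₁ s₂, σ => b.cost + 1 + if b.eval σ then s₁.cost σ else s₂.cost σ
  | .loop v e s, σ => e.cost + 1 + ∑ k ∈ Finset.range (e.eval σ),
      (1 + s.cost ((iterate v s.run σ k).setReg v k))

end Semantics

/-- A block of consecutive statements. -/
def block {V A D : Type} : List (Stmt V A D) → Stmt V A D
  | [] => .skip
  | s :: l => .seq s (block l)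

/-! ## The algorithm -/

/-- The registers. -/
inductive Reg where
  /-- the input `m + r` -/
  | n
  /-- the index of the current stack -/
  | i
  /-- the index of the current vertex in its stack -/
  | j
  /-- the coordinates of the current vertex -/
  | a | b
  /-- the length of the list of matrices -/
  | len
  /-- the index of the current matrix, and a row and a column of it -/
  | k | p | c
  /-- the beginnings of the current blocks of the old and of the new row vector -/
  | s | t
  /-- exponents and their shifts (used for polynomials only) -/
  | u | v | du | dv
  deriving DecidableEq

/-- The number arrays. -/
inductive Arr where
  /-- the input: the numbers of east and north steps of `P` and `Q` after `i` steps -/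
  | PE | PN | QE | QN
  /-- the list of matrices: numbers of rows, numbers of columns, entries -/
  | rows | cols | entry
  deriving DecidableEq

/-- The data arrays. -/
inductive Dat where
  /-- the row vector `T` -/
  | T
  /-- the row vector that is to become the new `T` -/
  | U
  /-- the values `1, x, y` of the weights (used for fixed `x` and `y` only) -/
  | W
  deriving DecidableEq

/-- Number expressions, tests and programs with these names. -/
abbrev NE := NExp Reg Arr
abbrev BE := BExp Reg Arr
abbrev Prog := Stmt Reg Arr Dat

/-- The point `(e₁ - e₂, e₂)`, which is `e₁` steps away from the origin, is a vertex of the lattice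
bounded by `P` and `Q`. -/
def inLattice (e₁ e₂ : NE) : BE :=
  .and (.le (.get .PN e₁) e₂) (.le e₂ (.get .QN e₁))

/-- The step from the current vertex `(a, b)` to its upper neighbour is a north step of `Q`. -/
def northStepOfQ : BE :=
  .and (.and (.eq (.get .QE Reg.i) Reg.a) (.eq (.get .QN Reg.i) Reg.b))
    (.and (.eq (.get .QE (Reg.i + 1)) Reg.a) (.eq (.get .QN (Reg.i + 1)) (Reg.b + 1)))

/-- The step from the current vertex `(a, b)` to its right neighbour is an east step of `P`. -/
def eastStepOfP : BE :=
  .and (.and (.eq (.get .PE Reg.i) Reg.a) (.eq (.get .PN Reg.i) Reg.b))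
    (.and (.eq (.get .PE (Reg.i + 1)) (Reg.a + 1)) (.eq (.get .PN (Reg.i + 1)) Reg.b))

/-- The cell that holds the entry in row `e₂` and column `e₃` of matrix number `e₁`; the matrices
have at most two rows and two columns. -/
def entryCell (e₁ e₂ e₃ : NE) : NE := (e₁ * 2 + e₂) * 2 + e₃

/-- Adds a row to the matrix under construction. -/
def addRow : Prog := .setArr .rows Reg.len (.get .rows Reg.len + 1)

/-- Adds a column to the matrix under construction, all of whose entries are the weight `w`. -/
def addColumn (w : NE) : Prog := block [
  .loop .p (.get .rows Reg.len)
    (.setArr .entry (entryCell Reg.len Reg.p (.get .cols Reg.len)) w),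
  .setArr .cols Reg.len (.get .cols Reg.len + 1)]

/-- Appends to the list the matrix `M_v` of the vertex `v = (a, b)` in stack `i`. It has a row for
each incoming edge (left, below) and a column for each outgoing edge (up, right), and a column is
filled with the weight of its edge. The matrix of `(0,0)` has one row; the matrix of `(m,r)` has
one column, with entries `1`. The weights `1`, `x`, `y` are written as `0`, `1`, `2`: north steps
of `Q` have weight `x`, east steps of `P` have weight `y`, and all other steps have weight `1`. -/
def appendMatrix : Prog := block [
  .setArr .rows Reg.len 0,
  .setArr .cols Reg.len 0,
  .ite (.eq Reg.i 0) addRow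
    (block [
      .ite (.and (.le 1 Reg.a) (inLattice (Reg.i - 1) Reg.b)) addRow .skip,
      .ite (.and (.le 1 Reg.b) (inLattice (Reg.i - 1) (Reg.b - 1))) addRow .skip]),
  .ite (.eq Reg.i Reg.n) (addColumn 0)
    (block [
      .ite (inLattice (Reg.i + 1) (Reg.b + 1))
        (.ite northStepOfQ (addColumn 1) (addColumn 0)) .skip,
      .ite (inLattice (Reg.i + 1) Reg.b)
        (.ite eastStepOfP (addColumn 2) (addColumn 0)) .skip]),
  .setReg .len (Reg.len + 1)]

/-- The operations on the entries of the row vectors that the algorithm uses, as programs. -/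
structure EntryOps where
  /-- preparations -/
  init : Prog
  /-- `T[e] ← 1` -/
  setOne : NE → Prog
  /-- `U[e] ← 0` -/
  clear : NE → Prog
  /-- `U[e₁] ← U[e₁] + T[e₂] * w`, where `w` is a weight -/
  addMul : NE → NE → NE → Prog
  /-- `T[e] ← U[e]` -/
  copy : NE → Prog

/-- The algorithm, with given operations on the entries of the row vectors. The result is the first
entry of `T`. -/
def algorithm (ops : EntryOps) : Prog := block [
  ops.init,
  -- `T ← (1)`
  ops.setOne 0,
  -- loop over all stacks
  .loop .i (Reg.n + 1) (block [
    -- the empty list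
    .setReg .len 0,
    -- loop over all vertices in stack `i`
    .loop .j (.get .QN Reg.i - .get .PN Reg.i + 1) (block [
      .setReg .a (.get .QE Reg.i + Reg.j),
      .setReg .b (.get .QN Reg.i - Reg.j),
      appendMatrix]),
    -- `U ← (T₁ A[1], T₂ A[2], …)`; block `T_k` starts at `s`, its image at `t`
    .setReg .s 0,
    .setReg .t 0,
    .loop .k Reg.len (block [
      .loop .c (.get .cols Reg.k) (block [
        ops.clear (Reg.t + Reg.c),
        .loop .p (.get .rows Reg.k)
          (ops.addMul (Reg.t + Reg.c) (Reg.s + Reg.p)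
            (.get .entry (entryCell Reg.k Reg.p Reg.c)))]),
      .setReg .s (Reg.s + .get .rows Reg.k),
      .setReg .t (Reg.t + .get .cols Reg.k)]),
    -- `T ← U`
    .loop .c Reg.t (ops.copy Reg.c)])]

/-- Fixed `x` and `y`: the entries of the row vectors are single elements of `R`. -/
def scalarOps : EntryOps where
  init := .setData .W 0 .one
  setOne e := .setData .T e .one
  clear e := .setData .U e .zero
  addMul e₁ e₂ w := .setData .U e₁ (.add (.get .U e₁) (.mul (.get .T e₂) (.get .W w)))
  copy e := .setData .T e (.get .U e)

/-- The cell that holds the coefficient of `x^e₁ y^e₂` of entry number `e` of a vector of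
polynomials; each polynomial has `(n + 2)²` cells. -/
def coeffCell (e e₁ e₂ : NE) : NE := (e * (Reg.n + 2) + e₁) * (Reg.n + 2) + e₂

/-- `d[e] ← 0` for a vector `d` of polynomials. -/
def clearPoly (d : Dat) (e : NE) : Prog :=
  .loop .u (Reg.n + 2) (.loop .v (Reg.n + 2) (.setData d (coeffCell e Reg.u Reg.v) .zero))

/-- Indeterminate `x` and `y`: the entries of the row vectors are polynomials, given by the arrays
of their integer coefficients, on which one operates coefficient by coefficient; multiplication by
`x` or `y` is a shift of the exponents. -/
def polyOps : EntryOps where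
  init := .skip
  setOne e := block [clearPoly .T e, .setData .T (coeffCell e 0 0) .one]
  clear e := clearPoly .U e
  addMul e₁ e₂ w := block [
    .ite (.eq w 1) (.setReg .du 1) (.setReg .du 0),
    .ite (.eq w 2) (.setReg .dv 1) (.setReg .dv 0),
    .loop .u (Reg.n + 1) (.loop .v (Reg.n + 1)
      (.setData .U (coeffCell e₁ (Reg.u + Reg.du) (Reg.v + Reg.dv))
        (.add (.get .U (coeffCell e₁ (Reg.u + Reg.du) (Reg.v + Reg.dv)))
          (.get .T (coeffCell e₂ Reg.u Reg.v)))))]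
  copy e := .loop .u (Reg.n + 2) (.loop .v (Reg.n + 2)
    (.setData .T (coeffCell e Reg.u Reg.v) (.get .U (coeffCell e Reg.u Reg.v))))

/-- The memory with the input `P`, `Q` (and `x`, `y`, as `W[1]` and `W[2]`); all the rest of it is
`0`. -/
def inputStore {m r : ℕ} {R : Type*} [CommRing R] (P Q : LatticePath m r) (x y : R) :
    Store Reg Arr Dat R where
  reg q := match q with
    | .n => m + r
    | _ => 0
  arr a e := if e ≤ m + r then
      match a with
      | .PE => P.easts e
      | .PN => P.norths e
      | .QE => Q.easts e
      | .QN => Q.norths e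
      | _ => 0
    else 0
  data d e := match d with
    | .W => if e = 1 then x else if e = 2 then y else 0
    | _ => 0

/-- The result of the algorithm for fixed values of `x` and `y`: the first entry of `T`. -/
def evalOutput {m r : ℕ} {R : Type*} [CommRing R] (P Q : LatticePath m r) (x y : R) : R :=
  ((algorithm scalarOps).run (inputStore P Q x y)).data .T 0

/-- The number of steps of the algorithm for fixed values of `x` and `y`. -/
def evalTime {m r : ℕ} {R : Type*} [CommRing R] (P Q : LatticePath m r) (x y : R) : ℕ :=
  (algorithm scalarOps).cost (inputStore P Q x y)

/-- The result of the algorithm for indeterminate `x` and `y`: the first entry of the vector `T` of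
polynomials, that is, the polynomial whose coefficients fill its first `(n + 2)²` cells. -/
noncomputable def polyOutput {m r : ℕ} (P Q : LatticePath m r) : MvPolynomial (Fin 2) ℤ :=
  ∑ k ∈ Finset.range (m + r + 2), ∑ l ∈ Finset.range (m + r + 2),
    MvPolynomial.C (((algorithm polyOps).run (inputStore P Q (0 : ℤ) 0)).data .T
      (k * (m + r + 2) + l)) * MvPolynomial.X 0 ^ k * MvPolynomial.X 1 ^ l

/-- The number of steps of the algorithm for indeterminate `x` and `y`. -/
def polyTime {m r : ℕ} (P Q : LatticePath m r) : ℕ :=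
  (algorithm polyOps).cost (inputStore P Q (0 : ℤ) 0)

end LatticeTutte

set_option linter.unusedSectionVars false
set_option linter.constructorNameAsVariable false

namespace LatticeTutte

/-! ## Rank and Tutte polynomial in terms of weighted path sums -/

/-! The rank of a set `A` in `M[P,Q]` is the largest number of north steps at positions of `A` on a
path of the region. `greedyRank` finds it by walking back from the end: at a position of `A` the
walk goes down whenever the lower boundary permits, at any other position it keeps its height
whenever the upper boundary permits. This is optimal because raising the height by one raises the
value by zero or one (`greedyRank_succ_height`), so a deviation from the greedy choice never pays.
The two halves are `count_inter_le_greedyRank` and `exists_count_inter_eq_greedyRank`.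

The Tutte sum then obeys deletion and contraction of the last position. If a path can end both with
an east and with a north step, the two contributions simply add up. If only an east step is
possible, the position is a loop and the factor is `(y - 1) + 1 = y`; if only a north step is
possible, it is a coloop and the factor is `(x - 1) + 1 = x`. These cases are exactly the east steps
of `P` and the north steps of `Q`, so the Tutte polynomial is the weighted path count `pathSum`
(`sum_greedyRank_eq_pathSum`, `tuttePolynomial_latticePathMatroid`).

The algorithm evaluates this count stack by stack. Before stack `i`, the vector `T` holds one path
sum for each edge that leads to the stack; adding up a block gives the path sum at a vertex, and
each column multiplies it by the weight of an outgoing edge. The bookkeeping rests on one fact: the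
edges between two consecutive stacks form a zigzag, along which the sum of the heights of the two
ends falls by one at a time, starting from `q i + q (i + 1)`. Listing left before below and up
before right follows this order on both sides, so the product is already arranged for the next stack
(`outValue_colOffset`, `sum_inValue_rowOffset`).

Correctness and running time are proved together by the judgement `Reaches`, and once for both kinds
of entries by `OpsSpec`, with a bound `K` on the cost of an entry operation. There are `n + 1`
stacks of at most `n + 1` vertices with matrices of size at most `2 × 2`, so `algorithm_reaches`
gives a bound of order `n² K`. For ring elements `K` is a constant; for coefficient arrays it is of
order `n²`. Path sums after `i` steps have degree at most `i` in each variable, so the arrays never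
overflow. -/

/-- The heights of the lower and upper boundary of a region of lattice points, indexed by the
distance from the origin. -/
structure IsRegion (p q : ℕ → ℕ) : Prop where
  lower_zero : p 0 = 0
  upper_zero : q 0 = 0
  lower_le_succ : ∀ i, p i ≤ p (i + 1)
  lower_succ_le : ∀ i, p (i + 1) ≤ p i + 1
  upper_le_succ : ∀ i, q i ≤ q (i + 1)
  upper_succ_le : ∀ i, q (i + 1) ≤ q i + 1
  le : ∀ i, p i ≤ q i

theorem IsRegion.upper_le {p q : ℕ → ℕ} (H : IsRegion p q) (i : ℕ) : q i ≤ i := by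
  induction i with
  | zero => exact H.upper_zero.le
  | succ i ih => have := H.upper_succ_le i; omega

/-- The rank of `A ∩ {0, …, k - 1}` among the paths of the region that end at height `h` after `k`
steps, computed by walking back greedily. -/
def greedyRank (p q : ℕ → ℕ) (A : Finset ℕ) : ℕ → ℕ → ℕ
  | 0, _ => 0
  | k + 1, h =>
    if k ∈ A then
      if p k + 1 ≤ h then greedyRank p q A k (h - 1) + 1 else greedyRank p q A k h
    else
      if h ≤ q k then greedyRank p q A k h else greedyRank p q A k (h - 1)

theorem greedyRank_congr (p q : ℕ → ℕ) {A B : Finset ℕ} (k h : ℕ)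
    (hAB : ∀ i < k, i ∈ A ↔ i ∈ B) : greedyRank p q A k h = greedyRank p q B k h := by
  induction k generalizing h with
  | zero => rfl
  | succ k ih =>
    have ih' := fun h => ih h fun i hi => hAB i (by omega)
    simp only [greedyRank, hAB k (by omega), ih']

/-- Makes the truncated exponents `h - rank` and `|A| - rank` genuine differences, so that a factor
`x - 1` or `y - 1` can be split off later. -/
theorem greedyRank_le {p q : ℕ → ℕ} (H : IsRegion p q) (A : Finset ℕ) (k h : ℕ)
    (h₁ : p k ≤ h) (h₂ : h ≤ q k) :
    greedyRank p q A k h ≤ h ∧ greedyRank p q A k h ≤ Nat.count (· ∈ A) k := by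
  induction k generalizing h with
  | zero => simp [greedyRank]
  | succ k ih =>
    have a1 := H.lower_le_succ k
    have a2 := H.lower_succ_le k
    have a3 := H.upper_le_succ k
    have a4 := H.upper_succ_le k
    have a5 := H.le k
    have e1 := ih h
    have e2 := ih (h - 1)
    rw [Nat.count_succ]
    simp only [greedyRank]
    split_ifs <;> omega

/-- The exchange property behind greediness: one unit of height is worth at most one north step in
`A`, and never a negative amount. -/
theorem greedyRank_succ_height {p q : ℕ → ℕ} (H : IsRegion p q) (A : Finset ℕ) (k h : ℕ)
    (h₁ : p k ≤ h) (h₂ : h + 1 ≤ q k) :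
    greedyRank p q A k h ≤ greedyRank p q A k (h + 1) ∧
      greedyRank p q A k (h + 1) ≤ greedyRank p q A k h + 1 := by
  induction k generalizing h with
  | zero => simp [greedyRank]
  | succ k ih =>
    have a1 := H.lower_le_succ k
    have a4 := H.upper_succ_le k
    have a5 := H.le k
    have e1 := ih h
    have e2 := ih (h - 1)
    -- At height `0` the expression `h - 1` is truncated, so the induction hypothesis one level down
    -- says nothing new there.
    rcases Nat.eq_zero_or_pos h with rfl | h0
    · simp only [greedyRank]
      simp only [zero_add, Nat.sub_self] at *
      split_ifs <;> omega
    · rw [Nat.sub_add_cancel h0] at e2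
      simp only [greedyRank, Nat.add_sub_cancel]
      split_ifs <;> omega

/-- `B` is the set of north steps of a path that stays in the region for `k` steps. -/
def StaysIn (p q : ℕ → ℕ) (B : Finset ℕ) (k : ℕ) : Prop :=
  ∀ i ≤ k, p i ≤ Nat.count (· ∈ B) i ∧ Nat.count (· ∈ B) i ≤ q i

/-- Where the path and the greedy walk disagree on the last step, their heights before it differ by
one, and `greedyRank_succ_height` covers the difference. -/
theorem count_inter_le_greedyRank {p q : ℕ → ℕ} (H : IsRegion p q) (A B : Finset ℕ) (k : ℕ)
    (hB : StaysIn p q B k) :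
    Nat.count (· ∈ A ∩ B) k ≤ greedyRank p q A k (Nat.count (· ∈ B) k) := by
  induction k with
  | zero => simp
  | succ k ih =>
    have e := ih fun i hi => hB i (by omega)
    have b1 := hB k (by omega)
    have b2 := hB (k + 1) le_rfl
    have s1 := greedyRank_succ_height H A k (Nat.count (· ∈ B) k)
    have s2 : p k ≤ Nat.count (· ∈ B) k - 1 → 1 ≤ Nat.count (· ∈ B) k →
        greedyRank p q A k (Nat.count (· ∈ B) k) ≤
          greedyRank p q A k (Nat.count (· ∈ B) k - 1) + 1 := fun h h' => by
      have := (greedyRank_succ_height H A k (Nat.count (· ∈ B) k - 1) h (by omega)).2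
      rwa [Nat.sub_add_cancel h'] at this
    rw [Nat.count_succ] at b2
    rw [Nat.count_succ, Nat.count_succ]
    generalize Nat.count (· ∈ A ∩ B) k = cI at *
    generalize Nat.count (· ∈ B) k = cB at *
    simp only [greedyRank, Finset.mem_inter]
    by_cases hA : k ∈ A <;> by_cases hk : k ∈ B <;>
      simp only [hA, hk, if_true, if_false, and_self, and_true, and_false, Nat.add_sub_cancel,
        add_zero] at * <;> split_ifs <;> omega

theorem count_congr_of_lt {a b : ℕ → Prop} [DecidablePred a] [DecidablePred b] (k : ℕ)
    (hab : ∀ i < k, a i ↔ b i) : Nat.count a k = Nat.count b k := by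
  rw [Nat.count_eq_card_filter_range, Nat.count_eq_card_filter_range]
  congr 1
  exact Finset.filter_congr fun i hi => hab i (Finset.mem_range.1 hi)

/-- Every choice of the greedy walk is a legal step: the boundaries move by at most one, so when one
of the two back steps leaves the region the other does not. Reversing the walk gives the path. -/
theorem exists_count_inter_eq_greedyRank {p q : ℕ → ℕ} (H : IsRegion p q) (A : Finset ℕ)
    (k h : ℕ) (h₁ : p k ≤ h) (h₂ : h ≤ q k) :
    ∃ B ⊆ Finset.range k, StaysIn p q B k ∧ Nat.count (· ∈ B) k = h ∧
      Nat.count (· ∈ A ∩ B) k = greedyRank p q A k h := by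
  induction k generalizing h with
  | zero =>
    have a1 := H.lower_zero
    have a2 := H.upper_zero
    refine ⟨∅, by simp, fun i hi => ?_, ?_, ?_⟩
    · obtain rfl : i = 0 := by omega
      simp [a1, a2]
    · simp; omega
    · simp [greedyRank]
  | succ k ih =>
    have a1 := H.lower_le_succ k
    have a2 := H.lower_succ_le k
    have a3 := H.upper_le_succ k
    have a4 := H.upper_succ_le k
    have a5 := H.le k
    have east : h ≤ q k → ∃ B ⊆ Finset.range (k + 1), StaysIn p q B (k + 1) ∧
        Nat.count (· ∈ B) (k + 1) = h ∧
        Nat.count (· ∈ A ∩ B) (k + 1) = greedyRank p q A k h := by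
      intro hq
      obtain ⟨B, hB, hs, hc, hr⟩ := ih h (by omega) hq
      have hk : k ∉ B := fun hk => by simpa using hB hk
      refine ⟨B, hB.trans (Finset.range_mono (by omega)), fun i hi => ?_, ?_, ?_⟩
      · rcases Nat.lt_or_ge k i with hi' | hi'
        · obtain rfl : i = k + 1 := by omega
          rw [Nat.count_succ, if_neg hk, hc]
          omega
        · exact hs i hi'
      · rw [Nat.count_succ, if_neg hk, hc]
        rfl
      · rw [Nat.count_succ, if_neg (by simp [hk]), hr]
        rfl
    have north : p k + 1 ≤ h → ∃ B ⊆ Finset.range (k + 1), StaysIn p q B (k + 1) ∧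
        Nat.count (· ∈ B) (k + 1) = h ∧
        Nat.count (· ∈ A ∩ B) (k + 1) =
          greedyRank p q A k (h - 1) + if k ∈ A then 1 else 0 := by
      intro hp
      obtain ⟨B, hB, hs, hc, hr⟩ := ih (h - 1) (by omega) (by omega)
      have hcount : ∀ i ≤ k, Nat.count (· ∈ insert k B) i = Nat.count (· ∈ B) i := fun i hi =>
        count_congr_of_lt i fun j hj => by simp [show j ≠ k by omega]
      have hcount' : Nat.count (· ∈ A ∩ insert k B) k = Nat.count (· ∈ A ∩ B) k :=
        count_congr_of_lt k fun j hj => by simp [show j ≠ k by omega]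
      refine ⟨insert k B, ?_, fun i hi => ?_, ?_, ?_⟩
      · rw [Finset.range_add_one]
        exact Finset.insert_subset_insert k hB
      · rcases Nat.lt_or_ge k i with hi' | hi'
        · obtain rfl : i = k + 1 := by omega
          rw [Nat.count_succ, hcount k le_rfl, hc, if_pos (Finset.mem_insert_self _ _)]
          omega
        · rw [hcount i hi']
          exact hs i hi'
      · rw [Nat.count_succ, hcount k le_rfl, hc, if_pos (Finset.mem_insert_self _ _)]
        omega
      · rw [Nat.count_succ, hcount', hr]
        simp
    simp only [greedyRank]
    split_ifs with c1 c2 c2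
    · simpa [c1] using north c2
    · exact east (by omega)
    · exact east c2
    · simpa [c1] using north (by omega)

/-! ### Deletion and contraction of the last position -/

section PathSum

variable {S : Type*} [CommRing S]

/-- The weight with a given number: `1`, `x` and `y` for `0`, `1` and `2`. -/
def weight (x y : S) (c : ℕ) : S := if c = 1 then x else if c = 2 then y else 1

/-- The number of the weight of the north step from height `h` after `i` steps. -/
def northCode (q : ℕ → ℕ) (i h : ℕ) : ℕ := if h = q i then 1 else 0

/-- The number of the weight of the east step from height `h` after `i` steps. -/
def eastCode (n : ℕ) (p : ℕ → ℕ) (i h : ℕ) : ℕ := if i < n ∧ h = p i then 2 else 0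

/-- The sum of the weights of the paths of the region that end at height `h` after `i` steps. -/
def pathSum (n : ℕ) (p q : ℕ → ℕ) (x y : S) : ℕ → ℕ → S
  | 0, _ => 1
  | i + 1, h => (if h ≤ q i then pathSum n p q x y i h * weight x y (eastCode n p i h) else 0) +
      (if p i + 1 ≤ h then
        pathSum n p q x y i (h - 1) * weight x y (northCode q i (h - 1)) else 0)

/-- The subsets are split according to whether they contain the last position; each half is a Tutte
sum for one step less, up to a factor `x - 1` or `y - 1` when the greedy walk is forced. -/
theorem sum_greedyRank_eq_pathSum {p q : ℕ → ℕ} (H : IsRegion p q) (x y : S) (n k h : ℕ)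
    (hk : k ≤ n) (h₁ : p k ≤ h) (h₂ : h ≤ q k) :
    ∑ A ∈ (Finset.range k).powerset, (x - 1) ^ (h - greedyRank p q A k h) *
      (y - 1) ^ (A.card - greedyRank p q A k h) = pathSum n p q x y k h := by
  induction k generalizing h with
  | zero =>
    have a2 := H.upper_zero
    obtain rfl : h = 0 := by omega
    simp [greedyRank, pathSum]
  | succ k ih =>
    have a1 := H.lower_le_succ k
    have a2 := H.lower_succ_le k
    have a3 := H.upper_le_succ k
    have a4 := H.upper_succ_le k
    have a5 := H.le k
    have hkn : k < n := by omega
    have e1 := ih h (by omega)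
    have e2 := ih (h - 1) (by omega)
    have hle : ∀ A ∈ (Finset.range k).powerset, ∀ g, p k ≤ g → g ≤ q k →
        greedyRank p q A k g ≤ g ∧ greedyRank p q A k g ≤ A.card := by
      intro A hA g hg hg'
      have e := greedyRank_le H A k g hg hg'
      refine ⟨e.1, e.2.trans ?_⟩
      rw [Nat.count_eq_card_filter_range]
      exact Finset.card_le_card fun i hi => (Finset.mem_filter.1 hi).2
    have hins : ∀ A : Finset ℕ, ∀ g,
        greedyRank p q (insert k A) k g = greedyRank p q A k g := fun A g =>
      greedyRank_congr p q k g fun i hi => by simp [show i ≠ k by omega]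
    have hout : ∑ A ∈ (Finset.range k).powerset, (x - 1) ^ (h - greedyRank p q A (k + 1) h) *
        (y - 1) ^ (A.card - greedyRank p q A (k + 1) h) =
        if h ≤ q k then pathSum n p q x y k h else (x - 1) * pathSum n p q x y k (h - 1) := by
      split_ifs with hq
      · rw [← e1 (by omega) (by omega)]
        refine Finset.sum_congr rfl fun A hA => ?_
        have hkA : k ∉ A := fun hc => by simpa using (Finset.mem_powerset.1 hA) hc
        simp only [greedyRank, if_neg hkA, if_pos hq]
      · rw [← e2 (by omega) (by omega), Finset.mul_sum]
        refine Finset.sum_congr rfl fun A hA => ?_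
        have hkA : k ∉ A := fun hc => by simpa using (Finset.mem_powerset.1 hA) hc
        have := hle A hA (h - 1) (by omega) (by omega)
        simp only [greedyRank, if_neg hkA, if_neg hq]
        -- A forced north step at a position outside `A` adds to the height but not to the rank.
        rw [show h - greedyRank p q A k (h - 1) = h - 1 - greedyRank p q A k (h - 1) + 1 by omega,
          pow_succ']
        ring
    have hin : ∑ A ∈ (Finset.range k).powerset,
        (x - 1) ^ (h - greedyRank p q (insert k A) (k + 1) h) *
        (y - 1) ^ ((insert k A).card - greedyRank p q (insert k A) (k + 1) h) =
        if p k + 1 ≤ h then pathSum n p q x y k (h - 1) else (y - 1) * pathSum n p q x y k h := by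
      split_ifs with hp
      · rw [← e2 (by omega) (by omega)]
        refine Finset.sum_congr rfl fun A hA => ?_
        have hkA : k ∉ A := fun hc => by simpa using (Finset.mem_powerset.1 hA) hc
        simp only [greedyRank, if_pos (Finset.mem_insert_self k A), if_pos hp, hins,
          Finset.card_insert_of_notMem hkA]
        rw [Nat.add_sub_add_right, show ∀ g, h - (g + 1) = h - 1 - g by omega]
      · rw [← e1 (by omega) (by omega), Finset.mul_sum]
        refine Finset.sum_congr rfl fun A hA => ?_
        have hkA : k ∉ A := fun hc => by simpa using (Finset.mem_powerset.1 hA) hc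
        have := hle A hA h (by omega) (by omega)
        simp only [greedyRank, if_pos (Finset.mem_insert_self k A), if_neg hp, hins,
          Finset.card_insert_of_notMem hkA]
        -- A forced east step at a position of the set adds to its size but not to the rank.
        rw [show A.card + 1 - greedyRank p q A k h = A.card - greedyRank p q A k h + 1 by omega,
          pow_succ']
        ring
    rw [Finset.range_add_one, Finset.sum_powerset_insert (by simp), hout, hin]
    simp only [pathSum]
    -- Neither element type, loop, coloop, and the impossible case `q k < h ≤ p k`, in this order.
    by_cases c1 : h ≤ q k <;> by_cases c2 : p k + 1 ≤ h
    · simp only [if_pos c1, if_pos c2, eastCode, northCode, if_neg (by omega : ¬ h - 1 = q k),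
        if_neg (by omega : ¬ (k < n ∧ h = p k))]
      simp [weight]
    · simp only [if_pos c1, if_neg c2, eastCode, if_pos (by omega : k < n ∧ h = p k)]
      simp only [weight, OfNat.ofNat_ne_one, if_false, if_true]
      ring
    · simp only [if_neg c1, if_pos c2, northCode, if_pos (by omega : h - 1 = q k)]
      simp only [weight, if_true]
      ring
    · omega

end PathSum

/-! ### The region bounded by two lattice paths -/

namespace LatticePath

theorem prefixCount_eq_count {n : ℕ} (S : Finset (Fin n)) (i : ℕ) :
    prefixCount S i = Nat.count (· ∈ S.map Fin.valEmbedding) i := by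
  rw [Nat.count_eq_card_filter_range, prefixCount, ← Finset.card_map Fin.valEmbedding]
  congr 1
  ext k
  simp only [Finset.mem_map, Finset.mem_filter, Finset.mem_univ, true_and,
    Fin.valEmbedding_apply, Finset.mem_range]
  constructor
  · rintro ⟨a, ⟨ha, hi⟩, rfl⟩
    exact ⟨hi, a, ha, rfl⟩
  · rintro ⟨hi, a, ha, rfl⟩
    exact ⟨a, ⟨ha, hi⟩, rfl⟩

theorem norths_of_le {m r : ℕ} (C : LatticePath m r) {i : ℕ} (hi : m + r ≤ i) :
    C.norths i = r := by
  rw [norths]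
  simp only [show ∀ k : Fin (m + r), k.val < i from fun k => by have := k.isLt; omega, and_true]
  simp [C.card_north]

theorem norths_zero {m r : ℕ} (C : LatticePath m r) : C.norths 0 = 0 := by
  simp [norths]

theorem norths_succ {m r : ℕ} (C : LatticePath m r) (i : ℕ) :
    C.norths (i + 1) = C.norths i + if i ∈ C.north.map Fin.valEmbedding then 1 else 0 := by
  rw [norths_eq, norths_eq, prefixCount_eq_count, prefixCount_eq_count, Nat.count_succ]

/-- The north counts are constant from `m + r` on, which is why the conditions hold at every index
and not only along the paths. -/
theorem isRegion {m r : ℕ} {P Q : LatticePath m r} (h : NeverAbove P Q) :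
    IsRegion P.norths Q.norths where
  lower_zero := P.norths_zero
  upper_zero := Q.norths_zero
  lower_le_succ i := by rw [norths_succ]; omega
  lower_succ_le i := by rw [norths_succ]; split_ifs <;> omega
  upper_le_succ i := by rw [norths_succ]; omega
  upper_succ_le i := by rw [norths_succ]; split_ifs <;> omega
  le i := by
    rcases le_total i (m + r) with hi | hi
    · exact (neverAbove_iff P Q).1 h i hi
    · rw [norths_of_le _ hi, norths_of_le _ hi]

end LatticePath

open LatticePath

/-! ### Rank and Tutte polynomial of `M[P,Q]` -/

theorem count_map_inter {n : ℕ} (A : Set (Fin n)) (A' : Finset ℕ)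
    (hA : ∀ k : Fin n, k ∈ A ↔ k.val ∈ A') (B : Finset (Fin n)) :
    (A ∩ B).encard = Nat.count (· ∈ A' ∩ B.map Fin.valEmbedding) n := by
  classical
  have h : A ∩ B = (B.filter (·.val ∈ A') : Finset (Fin n)) := by
    ext k
    simp [hA, and_comm]
  rw [h, Set.encard_coe_eq_coe_finsetCard, Nat.count_eq_card_filter_range,
    ← Finset.card_map Fin.valEmbedding]
  congr 2
  ext k
  simp only [Finset.mem_map, Finset.mem_filter, Fin.valEmbedding_apply, Finset.mem_range,
    Finset.mem_inter]
  constructor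
  · rintro ⟨a, ⟨ha, hi⟩, rfl⟩
    exact ⟨a.isLt, hi, a, ha, rfl⟩
  · rintro ⟨hi, h', a, ha, rfl⟩
    exact ⟨a, ⟨ha, h'⟩, rfl⟩

/-- The rank of `A` is the maximum of `|A ∩ B|` over the bases `B`. An independent subset of `A`
extends to a base, which gives the upper bound; the path found by the greedy walk is a base that
attains it. -/
theorem eRk_latticePathMatroid {m r : ℕ} {P Q : LatticePath m r} (h : NeverAbove P Q)
    (A : Set (Fin (m + r))) (A' : Finset ℕ) (hA : ∀ k : Fin (m + r), k ∈ A ↔ k.val ∈ A') :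
    (latticePathMatroid P Q h).eRk A = greedyRank P.norths Q.norths A' (m + r) r := by
  have hbase : ∀ B, (latticePathMatroid P Q h).IsBase B ↔ IsFullPathSet P Q B := fun B => Iff.rfl
  refine le_antisymm (Matroid.eRk_le_iff.2 fun I hIA hI => ?_) ?_
  · obtain ⟨B, hB, hIB⟩ := hI.exists_isBase_superset
    obtain ⟨C, rfl, hPC, hCQ⟩ := (hbase B).1 hB
    rw [neverAbove_iff] at hPC hCQ
    refine (Set.encard_le_encard (Set.subset_inter hIA hIB)).trans ?_
    rw [count_map_inter A A' hA]
    have e := count_inter_le_greedyRank (isRegion h) A' (C.north.map Fin.valEmbedding) (m + r)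
      fun i hi => by
        rw [← prefixCount_eq_count]
        exact ⟨hPC i hi, hCQ i hi⟩
    rw [← prefixCount_eq_count, prefixCount_top, C.card_north] at e
    exact_mod_cast e
  · obtain ⟨B, hB, hs, hc, hr⟩ := exists_count_inter_eq_greedyRank (isRegion h) A' (m + r) r
      (P.norths_of_le le_rfl).le (Q.norths_of_le le_rfl).ge
    set N : Finset (Fin (m + r)) := Finset.univ.filter (·.val ∈ B) with hN
    have hmap : N.map Fin.valEmbedding = B := by
      ext k
      simp only [hN, Finset.mem_map, Finset.mem_filter, Finset.mem_univ, true_and,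
        Fin.valEmbedding_apply]
      constructor
      · rintro ⟨a, ha, rfl⟩
        exact ha
      · exact fun hk => ⟨⟨k, Finset.mem_range.1 (hB hk)⟩, hk, rfl⟩
    have hcount : ∀ i, prefixCount N i = Nat.count (· ∈ B) i := fun i => by
      rw [prefixCount_eq_count, hmap]
    have hcard : N.card = r := by rw [← prefixCount_top, hcount, hc]
    have hNB : (latticePathMatroid P Q h).IsBase N := by
      refine (hbase _).2 ⟨⟨N, hcard⟩, rfl, ?_, ?_⟩ <;> rw [neverAbove_iff] <;> intro i hi
      · exact (hs i hi).1.trans_eq (hcount i).symm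
      · exact (hcount i).trans_le (hs i hi).2
    rw [← hr, ← hmap, ← count_map_inter A A' hA]
    exact (hNB.indep.subset Set.inter_subset_right).encard_le_eRk_of_subset Set.inter_subset_left

theorem ncard_eq_card {n : ℕ} (A : Set (Fin n)) (A' : Finset ℕ) (hA' : A' ⊆ Finset.range n)
    (hA : ∀ k : Fin n, k ∈ A ↔ k.val ∈ A') : A.ncard = A'.card := by
  rw [← Set.ncard_image_of_injective A Fin.val_injective, ← Set.ncard_coe_finset]
  congr 1
  ext k
  simp only [Set.mem_image, Finset.mem_coe]
  constructor
  · rintro ⟨a, ha, rfl⟩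
    exact (hA a).1 ha
  · exact fun hk => ⟨⟨k, Finset.mem_range.1 (hA' hk)⟩, (hA _).2 hk, rfl⟩

/-- The Tutte polynomial of a lattice path matroid is the weighted path sum. -/
theorem tuttePolynomial_latticePathMatroid {m r : ℕ} {P Q : LatticePath m r}
    (h : NeverAbove P Q) :
    tuttePolynomial (latticePathMatroid P Q h) = pathSum (m + r) P.norths Q.norths
      (MvPolynomial.X 0) (MvPolynomial.X 1) (m + r) r := by
  have hn := P.norths_of_le le_rfl
  have hn' := Q.norths_of_le le_rfl
  have hE : (latticePathMatroid P Q h).E = Set.univ := rfl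
  rw [← sum_greedyRank_eq_pathSum (isRegion h) _ _ _ _ _ le_rfl hn.le hn'.ge, tuttePolynomial,
    ← finsum_mem_coe_finset]
  symm
  have hrank : ∀ A : Set (Fin (m + r)), ∀ A' : Finset ℕ, (∀ k, k ∈ A ↔ k.val ∈ A') →
      rank (latticePathMatroid P Q h) A = greedyRank P.norths Q.norths A' (m + r) r :=
    fun A A' hA => by rw [rank, eRk_latticePathMatroid h A A' hA, ENat.toNat_natCast]
  -- The upper boundary `Q` itself is a base, and it has `r` elements.
  have htop : rank (latticePathMatroid P Q h) (latticePathMatroid P Q h).E = r := by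
    have hB : (latticePathMatroid P Q h).IsBase (Q.north : Set (Fin (m + r))) :=
      ⟨Q, rfl, h, (neverAbove_iff Q Q).2 fun _ _ => le_rfl⟩
    rw [rank, Matroid.eRk_ground, ← hB.encard_eq_eRank, Set.encard_coe_eq_coe_finsetCard,
      Q.card_north, ENat.toNat_natCast]
  refine finsum_mem_eq_of_bijOn (fun A' : Finset ℕ => {k : Fin (m + r) | k.val ∈ A'})
    ⟨fun A _ => by simp [hE], fun A hA B hB hAB => ?_, fun A _ => ?_⟩ fun A' hA' => ?_
  · ext k
    simp only [Finset.coe_powerset, Finset.coe_range, Set.mem_preimage, Set.mem_powerset_iff]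
      at hA hB
    have key : ∀ k : Fin (m + r), k.val ∈ A ↔ k.val ∈ B := fun k => by
      have := congrArg (k ∈ ·) hAB
      simpa using this
    constructor
    · exact fun hk => (key ⟨k, hA hk⟩).1 hk
    · exact fun hk => (key ⟨k, hB hk⟩).2 hk
  · classical
    refine ⟨Finset.univ.filter (fun k => k ∈ A) |>.map Fin.valEmbedding, ?_, ?_⟩
    · simp only [Finset.coe_powerset, Set.mem_preimage, Set.mem_powerset_iff]
      intro k hk
      simp only [Finset.coe_map, Set.mem_image] at hk
      obtain ⟨a, -, rfl⟩ := hk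
      simp
    · ext k
      simp [Fin.val_inj]
  · have hs : A' ⊆ Finset.range (m + r) := Finset.mem_powerset.1 (Finset.mem_coe.1 hA')
    rw [htop, hrank {k | k.val ∈ A'} A' fun k => Iff.rfl,
      ncard_eq_card {k | k.val ∈ A'} A' hs fun k => Iff.rfl]

/-- Taking images is a bijection between the subsets of the two ground sets that keeps rank and
cardinality. It extends the result to isomorphic matroids. -/
theorem tuttePolynomial_mapEmbedding {α β : Type*} (M : Matroid α) (f : α ↪ β) :
    tuttePolynomial (M.mapEmbedding f) = tuttePolynomial M := by
  have hrank : ∀ A ⊆ M.E, rank (M.mapEmbedding f) (f '' A) = rank M A := fun A hA => by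
    rw [rank, Matroid.mapEmbedding, Matroid.eRk_map M f.injective.injOn hA, rank]
  rw [tuttePolynomial, tuttePolynomial]
  symm
  refine finsum_mem_eq_of_bijOn (f '' ·) ⟨fun A hA => Set.image_mono hA,
    fun A _ B _ hAB => f.injective.image_injective hAB, fun A hA => ?_⟩ fun A hA => ?_
  · obtain ⟨B, hB, rfl⟩ := Set.subset_image_iff.1 hA
    exact ⟨B, hB, rfl⟩
  · rw [Matroid.mapEmbedding_ground_eq, hrank _ subset_rfl, hrank A hA,
      Set.ncard_image_of_injective A f.injective]

/-- Lets the formula for indeterminates be specialised to values `x`, `y` in any commutative ring.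
-/
theorem map_pathSum {S S' : Type*} [CommRing S] [CommRing S'] (φ : S →+* S') (n : ℕ)
    (p q : ℕ → ℕ) (x y : S) (i h : ℕ) :
    φ (pathSum n p q x y i h) = pathSum n p q (φ x) (φ y) i h := by
  have hw : ∀ c, φ (weight x y c) = weight (φ x) (φ y) c := fun c => by
    unfold weight
    split_ifs <;> simp
  induction i generalizing h with
  | zero => simp [pathSum]
  | succ i ih =>
    simp only [pathSum, map_add]
    split_ifs <;> simp [ih, hw]

theorem aeval_tuttePolynomial_latticePathMatroid {m r : ℕ} {P Q : LatticePath m r}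
    (h : NeverAbove P Q) {R : Type*} [CommRing R] (x y : R) :
    MvPolynomial.aeval ![x, y] (tuttePolynomial (latticePathMatroid P Q h)) =
      pathSum (m + r) P.norths Q.norths x y (m + r) r := by
  rw [tuttePolynomial_latticePathMatroid]
  refine (map_pathSum (MvPolynomial.aeval (R := ℤ) ![x, y]).toRingHom _ _ _ _ _ _ _).trans ?_
  simp

/-! ## Reasoning about programs -/

section Reaches

variable {V A D : Type} [DecidableEq V] [DecidableEq A] [DecidableEq D]
  {R : Type*} [CommRing R]

/-- Executed from `σ`, the program `s` establishes `Q` in at most `c` steps. -/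
def Reaches (s : Stmt V A D) (σ : Store V A D R) (c : ℕ) (Q : Store V A D R → Prop) : Prop :=
  Q (s.run σ) ∧ s.cost σ ≤ c

namespace Reaches

variable {s s₁ s₂ : Stmt V A D} {σ : Store V A D R} {c c₁ c₂ : ℕ} {Q Q' : Store V A D R → Prop}

theorem mono (h : Reaches s σ c₁ Q) (hc : c₁ ≤ c₂) (hQ : ∀ τ, Q τ → Q' τ) :
    Reaches s σ c₂ Q' := ⟨hQ _ h.1, h.2.trans hc⟩

theorem weaken (hc : c₁ ≤ c₂) (h : Reaches s σ c₁ Q) : Reaches s σ c₂ Q :=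
  h.mono hc fun _ => id

theorem skip (h : Q σ) : Reaches Stmt.skip σ 1 Q := ⟨h, le_rfl⟩

theorem setReg {v : V} {e : NExp V A} (h : Q (σ.setReg v (e.eval σ))) :
    Reaches (Stmt.setReg v e) σ (e.cost + 1) Q := ⟨h, le_rfl⟩

theorem setArr {a : A} {e₁ e₂ : NExp V A} (h : Q (σ.setArr a (e₁.eval σ) (e₂.eval σ))) :
    Reaches (Stmt.setArr a e₁ e₂) σ (e₁.cost + e₂.cost + 1) Q := ⟨h, le_rfl⟩

theorem setData {d : D} {e : NExp V A} {t : DExp V A D}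
    (h : Q (σ.setData d (e.eval σ) (t.eval σ))) :
    Reaches (Stmt.setData d e t) σ (e.cost + t.cost + 1) Q := ⟨h, le_rfl⟩

theorem nil (h : Q σ) : Reaches (block []) σ 1 Q := ⟨h, le_rfl⟩

theorem cons {l : List (Stmt V A D)} (h₁ : Reaches s σ c₁ Q')
    (h₂ : ∀ τ, Q' τ → Reaches (block l) τ c₂ Q) : Reaches (block (s :: l)) σ (c₁ + c₂) Q :=
  ⟨(h₂ _ h₁.1).1, Nat.add_le_add h₁.2 (h₂ _ h₁.1).2⟩

theorem ite {b : BExp V A} (h₁ : b.eval σ = true → Reaches s₁ σ c₁ Q)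
    (h₂ : b.eval σ = false → Reaches s₂ σ c₂ Q) :
    Reaches (Stmt.ite b s₁ s₂) σ (b.cost + 1 + (c₁ + c₂)) Q := by
  unfold Reaches
  cases hb : b.eval σ
  · simp only [Stmt.run, Stmt.cost, hb, Bool.false_eq_true, if_false]
    exact ⟨(h₂ hb).1, by have := (h₂ hb).2; omega⟩
  · simp only [Stmt.run, Stmt.cost, hb, if_true]
    exact ⟨(h₁ hb).1, by have := (h₁ hb).2; omega⟩

/-- The invariant is assumed before the counter is set, so it may ignore the counter. The bound on
the body is uniform over the iterations, and the `1` pays for the iteration itself. -/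
theorem loop {v : V} {e : NExp V A} (I : ℕ → Store V A D R → Prop) {N : ℕ}
    (hN : e.eval σ = N) (h0 : I 0 σ)
    (hs : ∀ k < N, ∀ τ, I k τ → Reaches s (τ.setReg v k) c (I (k + 1))) :
    Reaches (Stmt.loop v e s) σ (e.cost + 1 + N * (1 + c)) (I N) := by
  have key : ∀ k ≤ N, I k (iterate v s.run σ k) := by
    intro k
    induction k with
    | zero => exact fun _ => h0
    | succ k ih => exact fun hk => (hs k hk _ (ih (by omega))).1
  refine ⟨?_, ?_⟩
  · simp only [Stmt.run, hN]
    exact key N le_rfl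
  · simp only [Stmt.cost, hN]
    refine Nat.add_le_add_left ?_ _
    refine (Finset.sum_le_card_nsmul _ _ (1 + c) fun k hk => ?_).trans_eq (by simp)
    rw [Finset.mem_range] at hk
    exact Nat.add_le_add_left (hs k hk _ (key k hk.le)).2 _

end Reaches

variable (σ : Store V A D R)

@[simp] theorem NExp.eval_add (e₁ e₂ : NExp V A) : (e₁ + e₂).eval σ = e₁.eval σ + e₂.eval σ := rfl
@[simp] theorem NExp.eval_sub (e₁ e₂ : NExp V A) : (e₁ - e₂).eval σ = e₁.eval σ - e₂.eval σ := rfl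
@[simp] theorem NExp.eval_mul (e₁ e₂ : NExp V A) : (e₁ * e₂).eval σ = e₁.eval σ * e₂.eval σ := rfl
@[simp] theorem NExp.eval_ofNat (k : ℕ) : (no_index (OfNat.ofNat k) : NExp V A).eval σ = k := rfl
@[simp] theorem NExp.eval_reg (v : V) : (NExp.reg v : NExp V A).eval σ = σ.reg v := rfl
@[simp] theorem NExp.eval_get (a : A) (e : NExp V A) :
    (NExp.get a e).eval σ = σ.arr a (e.eval σ) := rfl
@[simp] theorem NExp.cost_add (e₁ e₂ : NExp V A) : (e₁ + e₂).cost = e₁.cost + e₂.cost + 1 := rfl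
@[simp] theorem NExp.cost_sub (e₁ e₂ : NExp V A) : (e₁ - e₂).cost = e₁.cost + e₂.cost + 1 := rfl
@[simp] theorem NExp.cost_mul (e₁ e₂ : NExp V A) : (e₁ * e₂).cost = e₁.cost + e₂.cost + 1 := rfl
@[simp] theorem NExp.cost_ofNat (k : ℕ) : (no_index (OfNat.ofNat k) : NExp V A).cost = 1 := rfl
@[simp] theorem NExp.cost_reg (v : V) : (NExp.reg v : NExp V A).cost = 1 := rfl
@[simp] theorem NExp.cost_get (a : A) (e : NExp V A) : (NExp.get a e).cost = e.cost + 1 := rfl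

@[simp] theorem Store.setReg_reg (v w : V) (k : ℕ) :
    (σ.setReg v k).reg w = if w = v then k else σ.reg w := by
  simp [Store.setReg, Function.update_apply]
@[simp] theorem Store.setReg_arr (v : V) (k : ℕ) : (σ.setReg v k).arr = σ.arr := rfl
@[simp] theorem Store.setReg_data (v : V) (k : ℕ) : (σ.setReg v k).data = σ.data := rfl
@[simp] theorem Store.setArr_reg (a : A) (i k : ℕ) : (σ.setArr a i k).reg = σ.reg := rfl
@[simp] theorem Store.setArr_arr (a b : A) (i j k : ℕ) :
    (σ.setArr a i k).arr b j = if b = a ∧ j = i then k else σ.arr b j := by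
  by_cases h : b = a
  · subst h
    simp [Store.setArr, Function.update_apply]
  · simp [Store.setArr, h]
@[simp] theorem Store.setArr_data (a : A) (i k : ℕ) : (σ.setArr a i k).data = σ.data := rfl
@[simp] theorem Store.setData_reg (d : D) (i : ℕ) (z : R) : (σ.setData d i z).reg = σ.reg := rfl
@[simp] theorem Store.setData_arr (d : D) (i : ℕ) (z : R) : (σ.setData d i z).arr = σ.arr := rfl
@[simp] theorem Store.setData_data (d d' : D) (i j : ℕ) (z : R) :
    (σ.setData d i z).data d' j = if d' = d ∧ j = i then z else σ.data d' j := by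
  by_cases h : d' = d
  · subst h
    simp [Store.setData, Function.update_apply]
  · simp [Store.setData, h]

end Reaches

/-! ## The list of matrices -/

section MatrixList

variable {R : Type*} [CommRing R]

/-- The input for the region with boundaries `p` and `q` is in its place. -/
structure HasInput (n : ℕ) (p q : ℕ → ℕ) (σ : Store Reg Arr Dat R) : Prop where
  reg_n : σ.reg .n = n
  arr_PN : ∀ i ≤ n, σ.arr .PN i = p i
  arr_QN : ∀ i ≤ n, σ.arr .QN i = q i
  arr_PE : ∀ i ≤ n, σ.arr .PE i = i - p i
  arr_QE : ∀ i ≤ n, σ.arr .QE i = i - q i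

/-- The number of rows of the matrix of the vertex at height `h` of stack `i`. The vertex `(0,0)`
gets an edge from the left. -/
def rowsNum (p q : ℕ → ℕ) (i h : ℕ) : ℕ :=
  (if h ≤ q (i - 1) then 1 else 0) + (if p (i - 1) + 1 ≤ h then 1 else 0)

/-- The numbers of the weights of the edges that leave the vertex at height `h` of stack `i`. The
last vertex gets an edge to the right. -/
def outCodes (n : ℕ) (p q : ℕ → ℕ) (i h : ℕ) : List ℕ :=
  (if h + 1 ≤ q (i + 1) then [northCode q i h] else []) ++
    (if p (i + 1) ≤ h then [eastCode n p i h] else [])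

/-- Matrix number `k` has `rows` rows, and columns filled with the numbers in `codes`. -/
def HasMatrix (σ : Store Reg Arr Dat R) (k rows : ℕ) (codes : List ℕ) : Prop :=
  σ.arr .rows k = rows ∧ σ.arr .cols k = codes.length ∧
    ∀ p < rows, ∀ c, ∀ hc : c < codes.length, σ.arr .entry ((k * 2 + p) * 2 + c) = codes[c]

/-- The memories agree except for matrix number `k` and for the registers in `l`. -/
structure AgreeUpTo (k : ℕ) (l : List Reg) (σ τ : Store Reg Arr Dat R) : Prop where
  data : τ.data = σ.data
  reg : ∀ v ∉ l, τ.reg v = σ.reg v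
  arr : ∀ a, a ≠ .rows → a ≠ .cols → a ≠ .entry → τ.arr a = σ.arr a
  rows : ∀ j ≠ k, τ.arr .rows j = σ.arr .rows j
  cols : ∀ j ≠ k, τ.arr .cols j = σ.arr .cols j
  entry : ∀ j < k * 4, τ.arr .entry j = σ.arr .entry j

theorem AgreeUpTo.refl (k : ℕ) (l : List Reg) (σ : Store Reg Arr Dat R) : AgreeUpTo k l σ σ :=
  ⟨rfl, fun _ _ => rfl, fun _ _ _ _ => rfl, fun _ _ => rfl, fun _ _ => rfl, fun _ _ => rfl⟩

theorem AgreeUpTo.trans {k : ℕ} {l : List Reg} {σ τ υ : Store Reg Arr Dat R}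
    (h₁ : AgreeUpTo k l σ τ) (h₂ : AgreeUpTo k l τ υ) : AgreeUpTo k l σ υ :=
  ⟨h₂.data.trans h₁.data, fun v hv => (h₂.reg v hv).trans (h₁.reg v hv),
    fun a h h' h'' => (h₂.arr a h h' h'').trans (h₁.arr a h h' h''),
    fun j hj => (h₂.rows j hj).trans (h₁.rows j hj),
    fun j hj => (h₂.cols j hj).trans (h₁.cols j hj),
    fun j hj => (h₂.entry j hj).trans (h₁.entry j hj)⟩

/-- Matrices of size at most `2 × 2` with an index below `k` lie in the entry cells below `4 k`,
which work on matrix `k` leaves alone. -/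
theorem AgreeUpTo.hasMatrix {k : ℕ} {l : List Reg} {σ τ : Store Reg Arr Dat R}
    (h : AgreeUpTo k l σ τ) {j rows : ℕ} {codes : List ℕ} (hj : j < k) (hr : rows ≤ 2)
    (hc : codes.length ≤ 2) (hm : HasMatrix σ j rows codes) : HasMatrix τ j rows codes := by
  refine ⟨(h.rows j hj.ne).trans hm.1, (h.cols j hj.ne).trans hm.2.1, fun p hp c hc' => ?_⟩
  rw [h.entry _ (by omega)]
  exact hm.2.2 p hp c hc'

theorem AgreeUpTo.hasInput {k : ℕ} {l : List Reg} {σ τ : Store Reg Arr Dat R}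
    (h : AgreeUpTo k l σ τ) (hl : Reg.n ∉ l) {n : ℕ} {p q : ℕ → ℕ} (hi : HasInput n p q σ) :
    HasInput n p q τ := by
  constructor
  · rw [h.reg _ hl, hi.reg_n]
  · rw [h.arr _ (by decide) (by decide) (by decide)]; exact hi.arr_PN
  · rw [h.arr _ (by decide) (by decide) (by decide)]; exact hi.arr_QN
  · rw [h.arr _ (by decide) (by decide) (by decide)]; exact hi.arr_PE
  · rw [h.arr _ (by decide) (by decide) (by decide)]; exact hi.arr_QE

theorem AgreeUpTo.setReg {k : ℕ} {l : List Reg} (σ : Store Reg Arr Dat R) {v : Reg} (hv : v ∈ l)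
    (z : ℕ) : AgreeUpTo k l σ (σ.setReg v z) := by
  refine ⟨rfl, fun w hw => ?_, fun _ _ _ _ => rfl, fun _ _ => rfl, fun _ _ => rfl,
    fun _ _ => rfl⟩
  have : w ≠ v := fun e => hw (e ▸ hv)
  simp [this]

/-- Rows are only added while there are no columns, so no entries have to be filled in. -/
theorem addRow_reaches (σ : Store Reg Arr Dat R) (k r : ℕ) (hlen : σ.reg .len = k)
    (hm : HasMatrix σ k r []) :
    Reaches addRow σ 10 fun τ => HasMatrix τ k (r + 1) [] ∧ AgreeUpTo k [] σ τ := by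
  refine Reaches.weaken (by decide) (Reaches.setArr ⟨⟨?_, ?_, ?_⟩, rfl, fun _ _ => rfl, ?_, ?_,
    ?_, ?_⟩)
  · simp [hlen, hm.1]
  · simp [hlen, hm.2.1]
  · intro p _ c hc
    simp at hc
  · intro a h1 h2 h3
    funext j
    simp [h1]
  · intro j hj
    simp [hlen, hj]
  · intro j hj
    simp
  · intro j hj
    simp

theorem addColumn_reaches (σ : Store Reg Arr Dat R) (k r w : ℕ) (codes : List ℕ) (e : NE)
    (he : ∀ τ : Store Reg Arr Dat R, e.eval τ = w) (hcost : e.cost = 1) (hr : r ≤ 2)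
    (hc : codes.length ≤ 1) (hlen : σ.reg .len = k) (hm : HasMatrix σ k r codes) :
    Reaches (addColumn e) σ 100 fun τ =>
      HasMatrix τ k r (codes ++ [w]) ∧ AgreeUpTo k [.p] σ τ := by
  -- The first `l` rows of the new column are filled; the column is not yet counted.
  set I : ℕ → Store Reg Arr Dat R → Prop := fun l τ => HasMatrix τ k r codes ∧
    AgreeUpTo k [.p] σ τ ∧ ∀ p < l, τ.arr .entry ((k * 2 + p) * 2 + codes.length) = w with hI
  refine Reaches.weaken ?_ (Reaches.cons (c₁ := 2 + 1 + r * (1 + 30)) (Q' := I r) (c₂ := 20) ?_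
    fun τ hτ => ?_)
  · have := Nat.mul_le_mul_right (1 + 30) hr
    omega
  · refine Reaches.weaken le_rfl (Reaches.loop (N := r) (c := 30) I ?_ ?_ fun l hl τ hτ => ?_)
    · simp [hlen, hm.1]
    · exact ⟨hm, AgreeUpTo.refl _ _ _, fun _ h => absurd h (Nat.not_lt_zero _)⟩
    · obtain ⟨h1, h2, h3⟩ := hτ
      have hl' : τ.reg .len = k := by rw [h2.reg _ (by decide), hlen]
      have hcell : (entryCell Reg.len Reg.p (.get .cols Reg.len)).eval (τ.setReg .p l) =
          (k * 2 + l) * 2 + codes.length := by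
        simp [entryCell, hl', h1.2.1]
      refine Reaches.weaken ?_ (Reaches.setArr ?_)
      · simp [entryCell, hcost]
      · rw [hcell, he]
        refine ⟨⟨?_, ?_, fun p hp c hc' => ?_⟩, h2.trans ⟨rfl, fun v hv => ?_, fun a _ _ ha => ?_,
          fun j _ => ?_, fun j _ => ?_, fun j hj => ?_⟩, fun p hp => ?_⟩
        · simp [h1.1]
        · simp [h1.2.1]
        -- An older column can only be column `0` while the new one is column `1`, so the two cells
        -- differ in parity.
        · simp only [Store.setArr_arr, true_and, Store.setReg_arr]
          rw [if_neg (by omega)]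
          exact h1.2.2 p hp c hc'
        · have : v ≠ .p := by simpa using hv
          simp [this]
        · funext j
          simp [ha]
        · simp
        · simp
        · simp only [Store.setArr_arr, true_and, Store.setReg_arr]
          rw [if_neg (by omega)]
        · simp only [Store.setArr_arr, true_and, Store.setReg_arr]
          split_ifs with hp'
          · rfl
          · exact h3 p (by omega)
  · obtain ⟨h1, h2, h3⟩ := hτ
    have hl' : τ.reg .len = k := by rw [h2.reg _ (by decide), hlen]
    refine Reaches.weaken (c₁ := 9) (by decide) (Reaches.cons (c₁ := 8) (c₂ := 1)
      (Reaches.weaken (by decide) (Reaches.setArr (Q := fun τ => HasMatrix τ k r (codes ++ [w]) ∧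
        AgreeUpTo k [.p] σ τ) ?_)) fun τ hτ => Reaches.nil hτ)
    refine ⟨⟨?_, ?_, fun p hp c hc' => ?_⟩, h2.trans ⟨rfl, fun v hv => rfl, fun a _ ha _ => ?_,
      fun j _ => ?_, fun j hj => ?_, fun j hj => ?_⟩⟩
    · simp [h1.1]
    · simp [hl', h1.2.1]
    · simp only [Store.setArr_arr, reduceCtorEq, false_and, if_false]
      rcases Nat.lt_or_ge c codes.length with h | h
      · rw [List.getElem_append_left h]
        exact h1.2.2 p hp c h
      · obtain rfl : c = codes.length := by
          simp only [List.length_append, List.length_singleton] at hc'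
          omega
        rw [h3 p hp]
        simp
    · funext j
      simp [ha]
    · simp
    · simp [hl', hj]
    · simp

end MatrixList

/-! ### The matrix of one vertex -/

section AppendMatrix

variable {R : Type*} [CommRing R]

/-- The boundaries `p` and `q` meet after `n` steps and turn east. -/
structure IsRegionOfLength (n : ℕ) (p q : ℕ → ℕ) : Prop extends IsRegion p q where
  top : p n = q n
  lower_succ_top : p (n + 1) = p n
  upper_succ_top : q (n + 1) = q n

theorem AgreeUpTo.mono {k : ℕ} {l l' : List Reg} {σ τ : Store Reg Arr Dat R}
    (h : AgreeUpTo k l σ τ) (hl : l ⊆ l') : AgreeUpTo k l' σ τ :=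
  ⟨h.data, fun v hv => h.reg v fun hv' => hv (hl hv'), h.arr, h.rows, h.cols, h.entry⟩

/-- Matrix number `k` is under construction, with the given numbers of rows and codes. -/
def InProgress (k : ℕ) (σ : Store Reg Arr Dat R) (rows : ℕ) (codes : List ℕ)
    (τ : Store Reg Arr Dat R) : Prop :=
  HasMatrix τ k rows codes ∧ AgreeUpTo k [.p] σ τ

theorem addRow_inProgress {k r : ℕ} {σ τ : Store Reg Arr Dat R} (hlen : σ.reg .len = k)
    (h : InProgress k σ r [] τ) : Reaches addRow τ 10 (InProgress k σ (r + 1) []) := by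
  have hl : τ.reg .len = k := by rw [h.2.reg _ (by decide), hlen]
  exact (addRow_reaches τ k r hl h.1).mono le_rfl fun υ hυ =>
    ⟨hυ.1, h.2.trans (hυ.2.mono (by simp))⟩

theorem addRowIf_inProgress {k r : ℕ} {σ τ : Store Reg Arr Dat R} (hlen : σ.reg .len = k)
    (h : InProgress k σ r [] τ) {b : BE} {φ : Prop} [Decidable φ] (hb : b.eval τ = decide φ) :
    Reaches (.ite b addRow .skip) τ (b.cost + 12)
      (InProgress k σ (r + if φ then 1 else 0) []) := by
  refine Reaches.weaken (by omega) (Reaches.ite (c₁ := 10) (c₂ := 1) (fun h' => ?_) fun h' => ?_)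
  · rw [hb, decide_eq_true_eq] at h'
    rw [if_pos h']
    exact addRow_inProgress hlen h
  · rw [hb, decide_eq_false_iff_not] at h'
    rw [if_neg h']
    exact Reaches.skip h

theorem addColumn_inProgress {k r : ℕ} {codes : List ℕ} {σ τ : Store Reg Arr Dat R}
    (hlen : σ.reg .len = k) (hr : r ≤ 2) (hc : codes.length ≤ 1)
    (h : InProgress k σ r codes τ) (w : ℕ) :
    Reaches (addColumn (.lit w)) τ 100 (InProgress k σ r (codes ++ [w])) := by
  have hl : τ.reg .len = k := by rw [h.2.reg _ (by decide), hlen]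
  exact (addColumn_reaches τ k r w codes (.lit w) (fun _ => rfl) rfl hr hc hl h.1).mono le_rfl
    fun υ hυ => ⟨hυ.1, h.2.trans hυ.2⟩

/-- The inner test and the code have to be right only under `φ`: whether an edge lies on the
boundary is asked only for edges that exist. -/
theorem addColumnIf_inProgress {k r : ℕ} {codes : List ℕ} {σ τ : Store Reg Arr Dat R}
    (hlen : σ.reg .len = k) (hr : r ≤ 2) (hc : codes.length ≤ 1)
    (h : InProgress k σ r codes τ) {b b' : BE} {φ ψ : Prop} [Decidable φ] [Decidable ψ] {w z : ℕ}
    (hb : b.eval τ = decide φ) (hb' : φ → b'.eval τ = decide ψ)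
    (hz : φ → z = if ψ then w else 0) :
    Reaches (.ite b (.ite b' (addColumn (.lit w)) (addColumn (.lit 0))) .skip) τ
      (b.cost + b'.cost + 203) (InProgress k σ r (codes ++ if φ then [z] else [])) := by
  refine Reaches.weaken (by omega) (Reaches.ite (c₁ := b'.cost + 1 + (100 + 100)) (c₂ := 1)
    (fun h' => ?_) fun h' => ?_)
  · rw [hb, decide_eq_true_eq] at h'
    rw [if_pos h', hz h']
    refine Reaches.ite (fun h'' => ?_) fun h'' => ?_
    · rw [hb' h', decide_eq_true_eq] at h''
      rw [if_pos h'']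
      exact addColumn_inProgress hlen hr hc h w
    · rw [hb' h', decide_eq_false_iff_not] at h''
      rw [if_neg h'']
      exact addColumn_inProgress hlen hr hc h 0
  · rw [hb, decide_eq_false_iff_not] at h'
    rw [if_neg h', List.append_nil]
    exact Reaches.skip h

theorem rowsNum_le (p q : ℕ → ℕ) (i h : ℕ) : rowsNum p q i h ≤ 2 := by
  unfold rowsNum
  split_ifs <;> omega

theorem outCodes_length (n : ℕ) (p q : ℕ → ℕ) (i h : ℕ) : (outCodes n p q i h).length =
    (if h + 1 ≤ q (i + 1) then 1 else 0) + (if p (i + 1) ≤ h then 1 else 0) := by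
  unfold outCodes
  split_ifs <;> simp

theorem outCodes_length_le (n : ℕ) (p q : ℕ → ℕ) (i h : ℕ) :
    (outCodes n p q i h).length ≤ 2 := by
  rw [outCodes_length]
  split_ifs <;> omega

/-- Since the vertex lies in the region and the boundaries move by at most one, each two-sided test
of the program reduces to the single inequality used in `rowsNum` or `outCodes`. -/
theorem appendMatrix_reaches {n : ℕ} {p q : ℕ → ℕ} (H : IsRegionOfLength n p q)
    {σ : Store Reg Arr Dat R} (hin : HasInput n p q σ) {i h k : ℕ} (hi : i ≤ n) (h₁ : p i ≤ h)
    (h₂ : h ≤ q i) (hri : σ.reg .i = i) (hra : σ.reg .a = i - h) (hrb : σ.reg .b = h)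
    (hlen : σ.reg .len = k) :
    Reaches appendMatrix σ 1000 fun τ => HasMatrix τ k (rowsNum p q i h) (outCodes n p q i h) ∧
      AgreeUpTo k [.p, .len] σ τ ∧ τ.reg .len = k + 1 := by
  have hlow := H.lower_le_succ
  have hlow' := H.lower_succ_le
  have hup := H.upper_le_succ
  have hup' := H.upper_succ_le
  have hqi := H.upper_le
  have hpq := H.le
  have hval : ∀ {r codes τ}, InProgress k σ r codes τ → HasInput n p q τ ∧ τ.reg .i = i ∧
      τ.reg .a = i - h ∧ τ.reg .b = h := fun hτ =>
    ⟨hτ.2.hasInput (by decide) hin, by rw [hτ.2.reg _ (by decide), hri],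
      by rw [hτ.2.reg _ (by decide), hra], by rw [hτ.2.reg _ (by decide), hrb]⟩
  refine Reaches.weaken (c₁ := 10 + (10 + (100 + (800 + 10)))) (by decide)
    (Reaches.cons (Q' := fun τ => τ.arr .rows k = 0 ∧ AgreeUpTo k [.p] σ τ)
      (Reaches.weaken (by decide) (Reaches.setArr ?_)) fun τ hτ =>
    Reaches.cons (Q' := InProgress k σ 0 [])
      (Reaches.weaken (by decide) (Reaches.setArr ?_)) fun τ hτ =>
    Reaches.cons (Q' := InProgress k σ (rowsNum p q i h) []) ?_ fun τ hτ =>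
    Reaches.cons (Q' := InProgress k σ (rowsNum p q i h) (outCodes n p q i h)) ?_ fun τ hτ =>
    Reaches.weaken (by decide) (Reaches.cons (c₁ := 5) (c₂ := 1) (Q' := _)
      (Reaches.weaken (by decide) (Reaches.setReg ?_)) fun τ hτ => Reaches.nil hτ))
  · refine ⟨by simp [hlen], rfl, fun v hv => rfl, fun a ha _ _ => ?_, fun j hj => ?_,
      fun j hj => ?_, fun j hj => ?_⟩
    · funext j
      simp [ha]
    · simp [hlen, hj]
    · simp
    · simp
  · have hl : τ.reg .len = k := by rw [hτ.2.reg _ (by decide), hlen]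
    refine ⟨⟨by simp [hτ.1], by simp [hl], fun p _ c hc => by simp at hc⟩, hτ.2.trans
      ⟨rfl, fun v hv => rfl, fun a _ ha _ => ?_, fun j hj => ?_, fun j hj => ?_, fun j hj => ?_⟩⟩
    · funext j
      simp [ha]
    · simp
    · simp [hl, hj]
    · simp
  · obtain ⟨hin', hi', ha', hb'⟩ := hval hτ
    refine Reaches.weaken ?_ (Reaches.ite (c₁ := 10) (fun h0 => ?_) fun h0 =>
      Reaches.cons (addRowIf_inProgress (φ := h ≤ q (i - 1)) hlen hτ ?_) fun υ hυ =>
      Reaches.weaken le_rfl (Reaches.cons (Q' := InProgress k σ (rowsNum p q i h) []) (c₂ := 1)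
        ((addRowIf_inProgress (φ := p (i - 1) + 1 ≤ h) hlen hυ ?_).mono le_rfl fun υ hυ => ?_)
        fun υ hυ => Reaches.nil hυ))
    · decide
    · have h0 : i = 0 := by simpa [BExp.eval, hi'] using h0
      have := H.lower_zero
      have := H.upper_zero
      subst h0
      -- The truncation `0 - 1 = 0` supplies the one row of the origin: it acts as its own left
      -- neighbour.
      have hr : rowsNum p q 0 h = 0 + 1 := by
        unfold rowsNum
        simp only [Nat.zero_sub]
        split_ifs <;> omega
      rw [hr]
      exact addRow_inProgress hlen hτ
    -- The condition `1 ≤ a` is implied by `h ≤ q (i - 1) ≤ i - 1`.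
    · have h0 : i ≠ 0 := by simpa [BExp.eval, hi'] using h0
      have e := hlow (i - 1)
      have e' := hqi (i - 1)
      rw [Nat.sub_add_cancel (by omega)] at e
      simp only [BExp.eval, inLattice, NExp.eval_ofNat, NExp.eval_reg, NExp.eval_get,
        NExp.eval_sub, hi', ha', hb', hin'.arr_PN (i - 1) (by omega),
        hin'.arr_QN (i - 1) (by omega), ← Bool.decide_and]
      rw [decide_eq_decide]
      omega
    · obtain ⟨hin', hi', ha', hb'⟩ := hval hυ
      have h0 : i ≠ 0 := by simpa [BExp.eval, hτ.2.reg .i (by decide), hri] using h0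
      have e := hup' (i - 1)
      rw [Nat.sub_add_cancel (by omega)] at e
      simp only [BExp.eval, inLattice, NExp.eval_ofNat, NExp.eval_reg, NExp.eval_get,
        NExp.eval_sub, hi', hb', hin'.arr_PN (i - 1) (by omega),
        hin'.arr_QN (i - 1) (by omega), ← Bool.decide_and]
      rw [decide_eq_decide]
      omega
    · simpa [rowsNum] using hυ
  · obtain ⟨hin', hi', ha', hb'⟩ := hval hτ
    have e1 := hlow i
    have e2 := hlow' i
    have e3 := hup i
    have e4 := hup' i
    have e5 := hqi i
    have e6 := hpq i
    refine Reaches.weaken ?_ (Reaches.ite (c₁ := 100) (fun h0 => ?_) fun h0 =>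
      Reaches.cons (addColumnIf_inProgress (φ := h + 1 ≤ q (i + 1)) (ψ := h = q i)
        (z := northCode q i h) hlen (rowsNum_le p q i h) (by simp) hτ ?_ (fun hφ => ?_)
        fun hφ => rfl) fun υ hυ =>
      Reaches.weaken le_rfl (Reaches.cons
        (Q' := InProgress k σ (rowsNum p q i h) (outCodes n p q i h)) (c₂ := 1)
        ((addColumnIf_inProgress (φ := p (i + 1) ≤ h) (ψ := h = p i) (z := eastCode n p i h) hlen
          (rowsNum_le p q i h) ?_ hυ ?_ (fun hφ => ?_) fun hφ => ?_).mono le_rfl fun υ hυ => hυ)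
        fun υ hυ => Reaches.nil hυ))
    · decide
    · have h0 : i = n := by simpa [BExp.eval, hi', hin'.reg_n] using h0
      subst h0
      have f1 := H.top
      have f2 := H.lower_succ_top
      have f3 := H.upper_succ_top
      -- Both boundaries turn east after the last step, which produces the single column of `(m,r)`;
      -- the condition `i < n` in `eastCode` gives it weight `1` although it continues `P`.
      have hc : outCodes i p q i h = [] ++ [0] := by
        unfold outCodes eastCode
        rw [if_neg (by omega), if_pos (by omega), if_neg (by omega)]
      rw [hc]
      exact addColumn_inProgress hlen (rowsNum_le p q i h) (by simp) hτ 0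
    all_goals have h0 : i ≠ n := by simpa [BExp.eval, hτ.2.reg .i (by decide), hri,
      (hval hτ).1.reg_n] using h0
    · simp only [BExp.eval, inLattice, NExp.eval_ofNat, NExp.eval_reg, NExp.eval_get,
        NExp.eval_add, hi', hb', hin'.arr_PN (i + 1) (by omega),
        hin'.arr_QN (i + 1) (by omega), ← Bool.decide_and]
      rw [decide_eq_decide]
      omega
    -- The edge exists, so `h = q i` already forces `q (i + 1) = q i + 1`; the tests on the next
    -- point of `Q` then hold as well.
    · simp only [BExp.eval, northStepOfQ, NExp.eval_ofNat, NExp.eval_reg, NExp.eval_get,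
        NExp.eval_add, hi', ha', hb', hin'.arr_QE i (by omega), hin'.arr_QN i (by omega),
        hin'.arr_QE (i + 1) (by omega), hin'.arr_QN (i + 1) (by omega), ← Bool.decide_and]
      rw [decide_eq_decide]
      omega
    · split_ifs <;> simp
    · obtain ⟨hin', hi', ha', hb'⟩ := hval hυ
      simp only [BExp.eval, inLattice, NExp.eval_ofNat, NExp.eval_reg, NExp.eval_get,
        NExp.eval_add, hi', hb', hin'.arr_PN (i + 1) (by omega),
        hin'.arr_QN (i + 1) (by omega), ← Bool.decide_and]
      rw [decide_eq_decide]
      omega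
    · obtain ⟨hin', hi', ha', hb'⟩ := hval hυ
      simp only [BExp.eval, eastStepOfP, NExp.eval_ofNat, NExp.eval_reg, NExp.eval_get,
        NExp.eval_add, hi', ha', hb', hin'.arr_PE i (by omega), hin'.arr_PN i (by omega),
        hin'.arr_PE (i + 1) (by omega), hin'.arr_PN (i + 1) (by omega), ← Bool.decide_and]
      rw [decide_eq_decide]
      omega
    · simp [eastCode, show i < n by omega]
  · have hl : τ.reg .len = k := by rw [hτ.2.reg _ (by decide), hlen]
    refine ⟨?_, ?_, ?_⟩
    · exact hτ.1
    · exact (hτ.2.mono (by simp)).trans (AgreeUpTo.setReg τ (by simp) _)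
    · simp [hl]

end AppendMatrix

/-! ## The positions of the edges between two stacks in the row vector -/

section Layout

/-- The number of rows of the first `k` matrices of stack `i`. -/
def rowOffset (p q : ℕ → ℕ) (i k : ℕ) : ℕ := ∑ j ∈ Finset.range k, rowsNum p q i (q i - j)

/-- The number of columns of the first `k` matrices of stack `i`. -/
def colOffset (n : ℕ) (p q : ℕ → ℕ) (i k : ℕ) : ℕ :=
  ∑ j ∈ Finset.range k, (outCodes n p q i (q i - j)).length

/-- The number of edges that lead to stack `i`; there is one to stack `0`. -/
def inSize (n : ℕ) (p q : ℕ → ℕ) : ℕ → ℕ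
  | 0 => 1
  | i + 1 => colOffset n p q i (q i - p i + 1)

/-- Among the first `k` vertices, which exclude the lowest one, each has two incoming edges, except
that the top vertex has no left neighbour if `q` has just risen. At `k = 0` the truncated
subtraction gives `0`. -/
theorem rowOffset_eq {p q : ℕ → ℕ} (H : IsRegion p q) {i k : ℕ} (hk : k ≤ q i - p i) :
    rowOffset p q i k = 2 * k - (q i - q (i - 1)) := by
  have a1 := H.le i
  have a2 : p (i - 1) ≤ p i ∧ p i ≤ p (i - 1) + 1 ∧ q (i - 1) ≤ q i ∧ q i ≤ q (i - 1) + 1 := by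
    rcases i with _ | i
    · simp
    · exact ⟨H.lower_le_succ i, H.lower_succ_le i, H.upper_le_succ i, H.upper_succ_le i⟩
  induction k with
  | zero => simp [rowOffset]
  | succ k ih =>
    rw [rowOffset, Finset.sum_range_succ, ← rowOffset, ih (by omega), rowsNum]
    split_ifs <;> omega

/-- Each vertex but the lowest has two outgoing edges, except that the top vertex lacks the upward
one unless `q` rises. At `k = 0` the subtraction of `1` is truncated if `q` does not rise. -/
theorem colOffset_eq {p q : ℕ → ℕ} (H : IsRegion p q) (n : ℕ) {i k : ℕ} (hk : k ≤ q i - p i) :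
    colOffset n p q i k = 2 * k + (q (i + 1) - q i) - 1 := by
  have a1 := H.le i
  have a2 := H.lower_le_succ i
  have a3 := H.lower_succ_le i
  have a4 := H.upper_le_succ i
  have a5 := H.upper_succ_le i
  induction k with
  | zero =>
    simp only [colOffset, Finset.range_zero, Finset.sum_empty]
    omega
  | succ k ih =>
    rw [colOffset, Finset.sum_range_succ, ← colOffset, ih (by omega), outCodes_length]
    split_ifs <;> omega

/-- The sums of the end heights take every value from `p i + p (i + 1)` to `q i + q (i + 1)` exactly
once. -/
theorem inSize_succ {p q : ℕ → ℕ} (H : IsRegion p q) (n i : ℕ) :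
    inSize n p q (i + 1) = q i + q (i + 1) - p i - p (i + 1) + 1 := by
  have a1 := H.le i
  have a2 := H.lower_le_succ i
  have a3 := H.lower_succ_le i
  have a4 := H.upper_le_succ i
  have a5 := H.upper_succ_le i
  have a6 := H.le (i + 1)
  rw [inSize, colOffset, Finset.sum_range_succ, ← colOffset, colOffset_eq H n le_rfl,
    outCodes_length]
  split_ifs <;> omega

theorem rowOffset_add_lt_inSize {p q : ℕ → ℕ} (H : IsRegion p q) (n : ℕ) {i k l : ℕ}
    (hk : k ≤ q i - p i) (hl : l < rowsNum p q i (q i - k)) :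
    rowOffset p q i k + l < inSize n p q i := by
  rw [rowOffset_eq H hk]
  rw [rowsNum] at hl
  rcases i with _ | i
  · have := H.upper_zero
    simp only [inSize, this, Nat.zero_sub] at *
    split_ifs at hl <;> omega
  · have a1 := H.le (i + 1)
    have a2 := H.lower_le_succ i
    have a3 := H.lower_succ_le i
    have a4 := H.upper_le_succ i
    have a5 := H.upper_succ_le i
    have a6 := H.le i
    rw [inSize_succ H]
    simp only [Nat.add_sub_cancel] at *
    split_ifs at hl <;> omega

variable {S : Type*} [CommRing S]

/-- The weighted path sum for the edge at position `e` among those that leave stack `i`. The heights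
of the ends of this edge add up to `q i + q (i + 1) - e`. -/
def outValue (n : ℕ) (p q : ℕ → ℕ) (x y : S) (i e : ℕ) : S :=
  pathSum n p q x y i ((q i + q (i + 1) - e) / 2) *
    weight x y (if (q i + q (i + 1) - e) % 2 = 1 then northCode q i ((q i + q (i + 1) - e) / 2)
      else eastCode n p i ((q i + q (i + 1) - e) / 2))

/-- The weighted path sum for the edge at position `e` among those that lead to stack `i`. -/
def inValue (n : ℕ) (p q : ℕ → ℕ) (x y : S) : ℕ → ℕ → S
  | 0, _ => 1
  | i + 1, e => outValue n p q x y i e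

theorem outValue_north (n : ℕ) (p q : ℕ → ℕ) (x y : S) {i e h : ℕ}
    (h' : q i + q (i + 1) - e = 2 * h + 1) :
    outValue n p q x y i e = pathSum n p q x y i h * weight x y (northCode q i h) := by
  rw [outValue, h', if_pos (by omega), show (2 * h + 1) / 2 = h by omega]

theorem outValue_east (n : ℕ) (p q : ℕ → ℕ) (x y : S) {i e h : ℕ}
    (h' : q i + q (i + 1) - e = 2 * h) :
    outValue n p q x y i e = pathSum n p q x y i h * weight x y (eastCode n p i h) := by
  rw [outValue, h', if_neg (by omega), show 2 * h / 2 = h by omega]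

/-- The columns come in the order of the zigzag: the upward edge has the odd height sum `2 h + 1`,
and the edge to the right follows with `2 h`. -/
theorem outValue_colOffset {p q : ℕ → ℕ} (H : IsRegion p q) (n : ℕ) (x y : S) {i k c : ℕ}
    (hk : k ≤ q i - p i) (hc : c < (outCodes n p q i (q i - k)).length) :
    outValue n p q x y i (colOffset n p q i k + c) =
      pathSum n p q x y i (q i - k) * weight x y (outCodes n p q i (q i - k))[c] := by
  have a1 := H.le i
  have a2 := H.lower_le_succ i
  have a3 := H.lower_succ_le i
  have a4 := H.upper_le_succ i
  have a5 := H.upper_succ_le i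
  rw [colOffset_eq H n hk]
  have hc' := hc
  rw [outCodes_length] at hc'
  by_cases c1 : q i - k + 1 ≤ q (i + 1)
  · rw [if_pos c1] at hc'
    rcases c with _ | c
    · rw [outValue_north n p q x y (h := q i - k) (by omega)]
      simp [outCodes, c1]
    · by_cases c2 : p (i + 1) ≤ q i - k
      · rw [if_pos c2] at hc'
        obtain rfl : c = 0 := by omega
        rw [outValue_east n p q x y (h := q i - k) (by omega)]
        simp [outCodes, c1, c2]
      · rw [if_neg c2] at hc'
        omega
  · rw [if_neg c1] at hc'
    by_cases c2 : p (i + 1) ≤ q i - k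
    · rw [if_pos c2] at hc'
      obtain rfl : c = 0 := by omega
      rw [outValue_east n p q x y (h := q i - k) (by omega)]
      simp [outCodes, c1, c2]
    · rw [if_neg c2] at hc'
      omega

/-- The block of a vertex consists of the edges from the left (sum `2 h`) and from below (sum `2 h -
1`), so adding it up is the recursion of `pathSum`. -/
theorem sum_inValue_rowOffset {p q : ℕ → ℕ} (H : IsRegion p q) (n : ℕ) (x y : S) {i k : ℕ}
    (hk : k ≤ q i - p i) :
    ∑ l ∈ Finset.range (rowsNum p q i (q i - k)), inValue n p q x y i (rowOffset p q i k + l) =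
      pathSum n p q x y i (q i - k) := by
  rw [rowOffset_eq H hk, rowsNum]
  rcases i with _ | i
  · simp [H.upper_zero, inValue, pathSum]
  · have a1 := H.le (i + 1)
    have a2 := H.lower_le_succ i
    have a3 := H.lower_succ_le i
    have a4 := H.upper_le_succ i
    have a5 := H.upper_succ_le i
    have a6 := H.le i
    simp only [Nat.add_sub_cancel, inValue, pathSum]
    by_cases c1 : q (i + 1) - k ≤ q i
    · have e0 := outValue_east n p q x y (i := i) (e := 2 * k - (q (i + 1) - q i) + 0)
        (h := q (i + 1) - k) (by omega)
      by_cases c2 : p i + 1 ≤ q (i + 1) - k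
      · have e1 := outValue_north n p q x y (i := i) (e := 2 * k - (q (i + 1) - q i) + 1)
          (h := q (i + 1) - k - 1) (by omega)
        simp only [if_pos c1, if_pos c2, Finset.sum_range_succ, Finset.sum_range_zero, zero_add,
          e0, e1]
      · simp only [if_pos c1, if_neg c2, Finset.sum_range_one, add_zero]
        simpa using e0
    · have c2 : p i + 1 ≤ q (i + 1) - k := by omega
      have e1 := outValue_north n p q x y (i := i) (e := 2 * k - (q (i + 1) - q i) + 0)
          (h := q (i + 1) - k - 1) (by omega)
      simp only [if_neg c1, if_pos c2, zero_add, Finset.sum_range_one, e1]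

/-- After the last stack, position `0` is the edge from the end point along the eastward
continuation of the boundaries, which has weight `1`. -/
theorem outValue_top {n : ℕ} {p q : ℕ → ℕ} (H : IsRegionOfLength n p q) (x y : S) :
    outValue n p q x y n 0 = pathSum n p q x y n (q n) := by
  have := H.upper_succ_top
  rw [outValue_east n p q x y (h := q n) (by omega)]
  simp [eastCode, weight]

end Layout

/-! ## Correctness of the algorithm for given operations -/

section Algorithm

variable {R S : Type*} [CommRing R] [CommRing S]

/-- The memories agree except for the data and the registers that operations on entries use. -/
def SameControl (σ τ : Store Reg Arr Dat R) : Prop :=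
  τ.arr = σ.arr ∧ ∀ v, v ∉ [Reg.u, .v, .du, .dv] → τ.reg v = σ.reg v

/-- Entry `e` of `d` becomes `f`, and all other entries are kept. -/
def Writes (Rep : (Dat → ℕ → R) → Dat → ℕ → S → Prop) (d : Dat) (e : ℕ) (f : S)
    (σ τ : Store Reg Arr Dat R) : Prop :=
  Rep τ.data d e f ∧ ∀ d' e' g, (d' ≠ d ∨ e' ≠ e) → Rep σ.data d' e' g → Rep τ.data d' e' g

/-- The operations are correct for the representation `Rep` of the elements of `S`, as long as
their degree, which is bounded by `Small`, is at most `n`; they preserve the property `Inv` of the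
data, which `init` establishes when started from `σ₀`, and each of them takes at most `K` steps. -/
structure OpsSpec (ops : EntryOps) (n : ℕ) (x y : S)
    (Rep : (Dat → ℕ → R) → Dat → ℕ → S → Prop) (Inv : (Dat → ℕ → R) → Prop)
    (Small : ℕ → S → Prop) (K : ℕ) (σ₀ : Store Reg Arr Dat R) : Prop where
  small_one : Small 0 1
  small_zero : ∀ i, Small i 0
  small_add : ∀ i f g, Small i f → Small i g → Small i (f + g)
  small_mul : ∀ i f c, Small i f → Small (i + 1) (f * weight x y c)
  small_mono : ∀ i j f, i ≤ j → Small i f → Small j f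
  init : Reaches ops.init σ₀ K fun τ => SameControl σ₀ τ ∧ Inv τ.data
  setOne : ∀ σ, σ.reg .n = n → Inv σ.data → Reaches (ops.setOne 0) σ K fun τ =>
    SameControl σ τ ∧ Inv τ.data ∧ Rep τ.data .T 0 1
  clear : ∀ σ, σ.reg .n = n → Inv σ.data → Reaches (ops.clear (Reg.t + Reg.c)) σ K fun τ =>
    SameControl σ τ ∧ Inv τ.data ∧ Writes Rep .U (σ.reg .t + σ.reg .c) 0 σ τ
  addMul : ∀ σ f g w, σ.reg .n = n → Inv σ.data →
    Rep σ.data .U (σ.reg .t + σ.reg .c) g → Rep σ.data .T (σ.reg .s + σ.reg .p) f → Small n f →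
    σ.arr .entry ((σ.reg .k * 2 + σ.reg .p) * 2 + σ.reg .c) = w → w ≤ 2 →
    Reaches (ops.addMul (Reg.t + Reg.c) (Reg.s + Reg.p)
      (.get .entry (entryCell Reg.k Reg.p Reg.c))) σ K fun τ =>
    SameControl σ τ ∧ Inv τ.data ∧
      Writes Rep .U (σ.reg .t + σ.reg .c) (g + f * weight x y w) σ τ
  copy : ∀ σ f, σ.reg .n = n → Inv σ.data → Rep σ.data .U (σ.reg .c) f →
    Reaches (ops.copy Reg.c) σ K fun τ =>
      SameControl σ τ ∧ Inv τ.data ∧ Writes Rep .T (σ.reg .c) f σ τ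

/-- The list of the matrices of stack `i` is complete, and `T` holds the path sums for the edges that
lead to stack `i`. -/
structure Ready (n : ℕ) (p q : ℕ → ℕ) (x y : S) (Rep : (Dat → ℕ → R) → Dat → ℕ → S → Prop)
    (Inv : (Dat → ℕ → R) → Prop) (i : ℕ) (σ : Store Reg Arr Dat R) : Prop where
  input : HasInput n p q σ
  reg_i : σ.reg .i = i
  reg_len : σ.reg .len = q i - p i + 1
  matrix : ∀ k < q i - p i + 1,
    HasMatrix σ k (rowsNum p q i (q i - k)) (outCodes n p q i (q i - k))
  inv : Inv σ.data
  rep : ∀ e < inSize n p q i, Rep σ.data .T e (inValue n p q x y i e)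

variable {n : ℕ} {p q : ℕ → ℕ} {x y : S} {Rep : (Dat → ℕ → R) → Dat → ℕ → S → Prop}
  {Inv : (Dat → ℕ → R) → Prop} {Small : ℕ → S → Prop} {K : ℕ} {i : ℕ}
  {σ τ σ₀ : Store Reg Arr Dat R} {ops : EntryOps}

theorem SameControl.reg (h : SameControl σ τ) (v : Reg)
    (hv : v ∉ [Reg.u, .v, .du, .dv] := by decide) : τ.reg v = σ.reg v := h.2 v hv

theorem SameControl.hasInput (h : SameControl σ τ) (hi : HasInput n p q σ) : HasInput n p q τ := by
  constructor
  · rw [h.reg .n]; exact hi.reg_n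
  all_goals rw [h.1]
  exacts [hi.arr_PN, hi.arr_QN, hi.arr_PE, hi.arr_QE]

theorem HasInput.setReg (h : HasInput n p q σ) {v : Reg} (hv : v ≠ .n) (z : ℕ) :
    HasInput n p q (σ.setReg v z) :=
  ⟨by simp [hv.symm, h.reg_n], h.arr_PN, h.arr_QN, h.arr_PE, h.arr_QE⟩

theorem Ready.setReg (h : Ready n p q x y Rep Inv i σ) (v : Reg) (z : ℕ)
    (hv : v ∉ [Reg.n, .i, .len] := by decide) :
    Ready n p q x y Rep Inv i (σ.setReg v z) := by
  simp only [List.mem_cons, List.not_mem_nil, or_false, not_or] at hv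
  exact ⟨h.input.setReg hv.1 z, by simp [Ne.symm hv.2.1, h.reg_i],
    by simp [Ne.symm hv.2.2, h.reg_len], h.matrix, h.inv, h.rep⟩

theorem Ready.of_sameControl (h : Ready n p q x y Rep Inv i σ) (hs : SameControl σ τ)
    (hinv : Inv τ.data) (hrep : ∀ e f, Rep σ.data .T e f → Rep τ.data .T e f) :
    Ready n p q x y Rep Inv i τ := by
  refine ⟨hs.hasInput h.input, by rw [hs.reg .i, h.reg_i], by rw [hs.reg .len, h.reg_len],
    fun k hk => ?_, hinv, fun e he => hrep _ _ (h.rep e he)⟩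
  have := h.matrix k hk
  unfold HasMatrix at *
  rwa [hs.1]

theorem outCodes_getElem_le {h c : ℕ} (hc : c < (outCodes n p q i h).length) :
    (outCodes n p q i h)[c] ≤ 2 := by
  have key : ∀ z ∈ outCodes n p q i h, z ≤ 2 := by
    intro z hz
    simp only [outCodes, northCode, eastCode, List.mem_append] at hz
    rcases hz with hz | hz <;> split_ifs at hz <;> simp at hz <;> omega
  exact key _ (List.getElem_mem hc)

namespace OpsSpec

variable (hops : OpsSpec ops n x y Rep Inv Small K σ₀)
include hops

/-- Each step multiplies by one weight, so the degree bound grows by at most one per step. -/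
theorem small_pathSum (i h : ℕ) : Small i (pathSum n p q x y i h) := by
  induction i generalizing h with
  | zero => exact hops.small_one
  | succ i ih =>
    refine hops.small_add _ _ _ ?_ ?_
    · split_ifs
      · exact hops.small_mul _ _ _ (ih _)
      · exact hops.small_zero _
    · split_ifs
      · exact hops.small_mul _ _ _ (ih _)
      · exact hops.small_zero _

theorem small_inValue (hi : i ≤ n) (e : ℕ) : Small n (inValue n p q x y i e) := by
  refine hops.small_mono i n _ hi ?_
  rcases i with _ | i
  · exact hops.small_one
  · exact hops.small_mul _ _ _ (hops.small_pathSum _ _)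

end OpsSpec

end Algorithm

/-! ### Multiplying the row vector by the matrices of a stack -/

section Algorithm

variable {R S : Type*} [CommRing R] [CommRing S]

/-- Block `k` of the product of the row vector with the matrices of stack `i` is being computed, and
all entries before position `e` are complete. -/
structure InBlock (n : ℕ) (p q : ℕ → ℕ) (x y : S) (Rep : (Dat → ℕ → R) → Dat → ℕ → S → Prop)
    (Inv : (Dat → ℕ → R) → Prop) (i k e : ℕ) (σ : Store Reg Arr Dat R) : Prop where
  ready : Ready n p q x y Rep Inv i σ
  reg_k : σ.reg .k = k
  reg_s : σ.reg .s = rowOffset p q i k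
  reg_t : σ.reg .t = colOffset n p q i k
  rep : ∀ e' < e, Rep σ.data .U e' (outValue n p q x y i e')

variable {n : ℕ} {p q : ℕ → ℕ} {x y : S} {Rep : (Dat → ℕ → R) → Dat → ℕ → S → Prop}
  {Inv : (Dat → ℕ → R) → Prop} {Small : ℕ → S → Prop} {K : ℕ} {i : ℕ}
  {σ τ σ₀ : Store Reg Arr Dat R} {ops : EntryOps}

theorem InBlock.setReg {k e : ℕ} (h : InBlock n p q x y Rep Inv i k e σ) (v : Reg) (z : ℕ)
    (hv : v ∉ [Reg.n, .i, .len, .k, .s, .t] := by decide) :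
    InBlock n p q x y Rep Inv i k e (σ.setReg v z) := by
  simp only [List.mem_cons, List.not_mem_nil, or_false, not_or] at hv
  exact ⟨h.ready.setReg v z (by simp [hv]), by simp [Ne.symm hv.2.2.2.1, h.reg_k],
    by simp [Ne.symm hv.2.2.2.2.1, h.reg_s], by simp [Ne.symm hv.2.2.2.2.2, h.reg_t], h.rep⟩

theorem InBlock.of_writes {k e e₀ : ℕ} {f : S} (h : InBlock n p q x y Rep Inv i k e σ)
    (hs : SameControl σ τ) (hinv : Inv τ.data) (hw : Writes Rep .U e₀ f σ τ) (he : e ≤ e₀) :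
    InBlock n p q x y Rep Inv i k e τ :=
  ⟨h.ready.of_sameControl hs hinv fun e' f' => hw.2 _ _ _ (Or.inl (by decide)),
    by rw [hs.reg .k, h.reg_k], by rw [hs.reg .s, h.reg_s], by rw [hs.reg .t, h.reg_t],
    fun e' he' => hw.2 _ _ _ (Or.inr (by omega)) (h.rep e' he')⟩

/-- The construction of the list of matrices. -/
theorem matrixList_reaches (H : IsRegionOfLength n p q) (hin : HasInput n p q σ) (hi : i ≤ n)
    (hri : σ.reg .i = i) (hlen : σ.reg .len = 0) :
    Reaches (.loop .j (.get .QN Reg.i - .get .PN Reg.i + 1) (block [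
      .setReg .a (.get .QE Reg.i + Reg.j),
      .setReg .b (.get .QN Reg.i - Reg.j),
      appendMatrix]) : Prog) σ (8 + (q i - p i + 1) * 1031) fun τ =>
      HasInput n p q τ ∧ τ.reg .i = i ∧ τ.reg .len = q i - p i + 1 ∧ τ.data = σ.data ∧
        ∀ k < q i - p i + 1,
          HasMatrix τ k (rowsNum p q i (q i - k)) (outCodes n p q i (q i - k)) := by
  refine Reaches.weaken le_rfl (Reaches.loop (N := q i - p i + 1) (c := 1030)
    (fun J τ => HasInput n p q τ ∧ τ.reg .i = i ∧ τ.reg .len = J ∧ τ.data = σ.data ∧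
        ∀ k < J, HasMatrix τ k (rowsNum p q i (q i - k)) (outCodes n p q i (q i - k)))
    ?_ ⟨hin, hri, hlen, rfl, fun _ h => absurd h (Nat.not_lt_zero _)⟩
    fun k hk τ ⟨h1, h2, h3, h4, h5⟩ => ?_)
  · simp [hri, hin.arr_QN i hi, hin.arr_PN i hi]
  · have e1 := H.upper_le i
    have e2 := H.le i
    refine Reaches.weaken (c₁ := 10 + (10 + (1000 + 1))) (by decide)
      (Reaches.cons (Q' := fun υ => υ = ((τ.setReg .j k).setReg .a (i - (q i - k))))
        (Reaches.weaken (by decide) (Reaches.setReg ?_)) fun υ hυ =>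
      Reaches.cons (Q' := fun υ => υ = (((τ.setReg .j k).setReg .a (i - (q i - k))).setReg .b
        (q i - k))) (Reaches.weaken (by decide) (Reaches.setReg ?_)) fun υ hυ =>
      Reaches.cons (Q' := _) ?_ fun υ hυ => Reaches.nil hυ)
    · simp only [NExp.eval_add, NExp.eval_get, NExp.eval_reg, Store.setReg_reg, Store.setReg_arr,
        reduceCtorEq, if_false, if_true, h2, h1.arr_QE i hi]
      congr 1
      omega
    · subst hυ
      simp [h2, h1.arr_QN i hi]
    · subst hυ
      refine (appendMatrix_reaches H (((h1.setReg (by decide) _).setReg (by decide) _).setReg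
        (by decide) _) hi (h := q i - k) (k := k) (by omega) (by omega) (by simp [h2])
        (by simp) (by simp) (by simp [h3])).mono le_rfl fun υ hυ => ?_
      obtain ⟨g1, g2, g3⟩ := hυ
      refine ⟨g2.hasInput (by decide) (((h1.setReg (by decide) _).setReg (by decide) _).setReg
        (by decide) _), ?_, g3, ?_, fun l hl => ?_⟩
      · rw [g2.reg _ (by decide)]
        simp [h2]
      · rw [g2.data]
        exact h4
      · rcases Nat.lt_or_ge l k with hl' | hl'
        · exact g2.hasMatrix hl' (rowsNum_le p q i _) (outCodes_length_le n p q i _) (h5 l hl')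
        · obtain rfl : l = k := by omega
          exact g1

namespace OpsSpec

variable (hops : OpsSpec ops n x y Rep Inv Small K σ₀)
include hops

/-- The computation of one entry of the product. -/
theorem column_reaches (H : IsRegionOfLength n p q) (hi : i ≤ n) {k c : ℕ} (hk : k ≤ q i - p i)
    (hc : c < (outCodes n p q i (q i - k)).length)
    (hσ : InBlock n p q x y Rep Inv i k (colOffset n p q i k + c) σ) (hrc : σ.reg .c = c) :
    Reaches ((block [
        ops.clear (Reg.t + Reg.c),
        .loop .p (.get .rows Reg.k)
          (ops.addMul (Reg.t + Reg.c) (Reg.s + Reg.p)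
            (.get .entry (entryCell Reg.k Reg.p Reg.c)))]) : Prog) σ (3 * K + 6)
      (InBlock n p q x y Rep Inv i k (colOffset n p q i k + (c + 1))) := by
  have hin := hσ.ready.input.reg_n
  have hm := hσ.ready.matrix k (by omega)
  set w := (outCodes n p q i (q i - k))[c] with hw
  set e := colOffset n p q i k + c with he
  have hrows := rowsNum_le p q i (q i - k)
  refine Reaches.weaken (c₁ := K + (2 + 1 + rowsNum p q i (q i - k) * (1 + K) + 1)) ?_
    (Reaches.cons (Q' := fun τ => InBlock n p q x y Rep Inv i k e τ ∧ τ.reg .c = c ∧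
      Rep τ.data .U e 0) ((hops.clear σ hin hσ.ready.inv).mono le_rfl fun τ hτ => ?_)
      fun τ hτ => Reaches.cons (Q' := _) (Reaches.loop (N := rowsNum p q i (q i - k))
        -- The partial sum over the first `l` rows; the weight is the same in all of them, as a
        -- column is constant.
        (fun l τ => InBlock n p q x y Rep Inv i k e τ ∧ τ.reg .c = c ∧
          Rep τ.data .U e (∑ l' ∈ Finset.range l,
            inValue n p q x y i (rowOffset p q i k + l') * weight x y w))
        ?_ ?_ fun l hl τ hτ => ?_) fun τ hτ => Reaches.nil ?_)
  · have := Nat.mul_le_mul_right (1 + K) hrows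
    omega
  · obtain ⟨h1, h2, h3⟩ := hτ
    rw [hσ.reg_t, hrc] at h3
    exact ⟨hσ.of_writes h1 h2 h3 le_rfl, by rw [h1.reg .c, hrc], h3.1⟩
  · have := hτ.1.ready.matrix k (by omega)
    simp [hτ.1.reg_k, this.1]
  · simpa using hτ
  · obtain ⟨h1, h2, h3⟩ := hτ
    have hm := h1.ready.matrix k (by omega)
    have hlt := rowOffset_add_lt_inSize H.toIsRegion n hk hl
    have key := hops.addMul (τ.setReg .p l) (inValue n p q x y i (rowOffset p q i k + l))
      (∑ l' ∈ Finset.range l, inValue n p q x y i (rowOffset p q i k + l') * weight x y w) w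
      (h1.setReg .p l).ready.input.reg_n h1.ready.inv
      (by simpa [h1.reg_t, h2] using h3)
      (by simpa [h1.reg_s] using h1.ready.rep _ hlt)
      (hops.small_inValue hi _)
      (by simpa [h1.reg_k, h2] using hm.2.2 l hl c hc) (outCodes_getElem_le hc)
    refine key.mono le_rfl fun υ hυ => ?_
    obtain ⟨g1, g2, g3⟩ := hυ
    simp only [Store.setReg_reg, reduceCtorEq, if_false, h1.reg_t, h2, ← he] at g3
    refine ⟨(h1.setReg .p l).of_writes g1 g2 g3 le_rfl, ?_, ?_⟩
    · rw [g1.reg .c]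
      simpa using h2
    · rw [Finset.sum_range_succ]
      exact g3.1
  · obtain ⟨h1, h2, h3⟩ := hτ
    refine ⟨h1.ready, h1.reg_k, h1.reg_s, h1.reg_t, fun e' he' => ?_⟩
    rcases Nat.lt_or_ge e' e with h | h
    · exact h1.rep e' h
    · obtain rfl : e' = e := by omega
      -- The common weight is factored out, and what remains is the path sum at the vertex.
      rw [← Finset.sum_mul, sum_inValue_rowOffset H.toIsRegion n x y hk] at h3
      rw [he, outValue_colOffset H.toIsRegion n x y hk hc]
      exact h3

/-- The computation of one block of the product. -/
theorem block_reaches (H : IsRegionOfLength n p q) (hi : i ≤ n) {k : ℕ} (hk : k ≤ q i - p i)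
    (hσ : InBlock n p q x y Rep Inv i k (colOffset n p q i k) σ) :
    Reaches ((block [
      .loop .c (.get .cols Reg.k) (block [
        ops.clear (Reg.t + Reg.c),
        .loop .p (.get .rows Reg.k)
          (ops.addMul (Reg.t + Reg.c) (Reg.s + Reg.p)
            (.get .entry (entryCell Reg.k Reg.p Reg.c)))]),
      .setReg .s (Reg.s + .get .rows Reg.k),
      .setReg .t (Reg.t + .get .cols Reg.k)]) : Prog) σ (6 * K + 40) fun τ =>
      Ready n p q x y Rep Inv i τ ∧ τ.reg .s = rowOffset p q i (k + 1) ∧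
      τ.reg .t = colOffset n p q i (k + 1) ∧
      ∀ e < colOffset n p q i (k + 1), Rep τ.data .U e (outValue n p q x y i e) := by
  have hm := hσ.ready.matrix k (by omega)
  have hcols := outCodes_length_le n p q i (q i - k)
  have hcol : colOffset n p q i (k + 1) =
      colOffset n p q i k + (outCodes n p q i (q i - k)).length := Finset.sum_range_succ _ _
  have hrow : rowOffset p q i (k + 1) = rowOffset p q i k + rowsNum p q i (q i - k) :=
    Finset.sum_range_succ _ _
  refine Reaches.weaken (c₁ := (2 + 1 + (outCodes n p q i (q i - k)).length *
      (1 + (3 * K + 6))) + (6 + (6 + 1))) ?_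
    (Reaches.cons (Q' := _) (Reaches.loop (N := (outCodes n p q i (q i - k)).length)
      (fun c τ => InBlock n p q x y Rep Inv i k (colOffset n p q i k + c) τ) ?_ hσ
      fun c hc τ hτ => hops.column_reaches H hi hk hc (hτ.setReg .c c) (by simp)) fun τ hτ =>
    Reaches.cons (Q' := fun υ => Ready n p q x y Rep Inv i υ ∧ υ.reg .k = k ∧
        υ.reg .s = rowOffset p q i (k + 1) ∧ υ.reg .t = colOffset n p q i k ∧
        ∀ e < colOffset n p q i (k + 1), Rep υ.data .U e (outValue n p q x y i e))
      (Reaches.weaken (by decide) (Reaches.setReg ?_)) fun υ hυ =>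
    Reaches.cons (Q' := _) (Reaches.weaken (by decide) (Reaches.setReg ?_)) fun υ hυ =>
      Reaches.nil hυ)
  · have := Nat.mul_le_mul_right (1 + (3 * K + 6)) hcols
    omega
  · simp [hσ.reg_k, hm.2.1]
  · have hm := hτ.ready.matrix k (by omega)
    refine ⟨hτ.ready.setReg _ _, by simp [hτ.reg_k], ?_, by simp [hτ.reg_t], ?_⟩
    · simp [hτ.reg_s, hτ.reg_k, hm.1, hrow]
    · rw [hcol]
      exact hτ.rep
  · obtain ⟨h1, h2, h3, h4, h5⟩ := hυ
    have hm := h1.matrix k (by omega)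
    refine ⟨h1.setReg _ _, by simp [h3], ?_, h5⟩
    simp [h4, h2, hm.2.1, hcol]

end OpsSpec

/-- `T` holds the path sums for the edges that lead to stack `i`. -/
structure AtStack (n : ℕ) (p q : ℕ → ℕ) (x y : S) (Rep : (Dat → ℕ → R) → Dat → ℕ → S → Prop)
    (Inv : (Dat → ℕ → R) → Prop) (i : ℕ) (σ : Store Reg Arr Dat R) : Prop where
  input : HasInput n p q σ
  inv : Inv σ.data
  rep : ∀ e < inSize n p q i, Rep σ.data .T e (inValue n p q x y i e)

namespace OpsSpec

variable (hops : OpsSpec ops n x y Rep Inv Small K σ₀)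
include hops

/-- The work on one stack. -/
theorem stack_reaches (H : IsRegionOfLength n p q) (hi : i ≤ n)
    (hσ : AtStack n p q x y Rep Inv i σ) (hri : σ.reg .i = i) :
    Reaches ((block [
    .setReg .len 0,
    .loop .j (.get .QN Reg.i - .get .PN Reg.i + 1) (block [
      .setReg .a (.get .QE Reg.i + Reg.j),
      .setReg .b (.get .QN Reg.i - Reg.j),
      appendMatrix]),
    .setReg .s 0,
    .setReg .t 0,
    .loop .k Reg.len (block [
      .loop .c (.get .cols Reg.k) (block [
        ops.clear (Reg.t + Reg.c),
        .loop .p (.get .rows Reg.k)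
          (ops.addMul (Reg.t + Reg.c) (Reg.s + Reg.p)
            (.get .entry (entryCell Reg.k Reg.p Reg.c)))]),
      .setReg .s (Reg.s + .get .rows Reg.k),
      .setReg .t (Reg.t + .get .cols Reg.k)]),
    .loop .c Reg.t (ops.copy Reg.c)]) : Prog) σ ((n + 1) * (8 * K + 1200))
      (AtStack n p q x y Rep Inv (i + 1)) := by
  have hL : q i - p i + 1 ≤ n + 1 := by
    have := H.upper_le i
    omega
  set L := q i - p i + 1 with hLdef
  -- At most `n + 1` vertices with at most two outgoing edges each; this bounds the copying of `U`
  -- to `T`.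
  have ht : colOffset n p q i L ≤ 2 * (n + 1) := by
    have : colOffset n p q i L ≤ (Finset.range L).card • 2 :=
      Finset.sum_le_card_nsmul _ _ _ fun j _ => outCodes_length_le n p q i _
    rw [Finset.card_range, smul_eq_mul] at this
    omega
  set B : ℕ → Store Reg Arr Dat R → Prop := fun k τ =>
    Ready n p q x y Rep Inv i τ ∧ τ.reg .s = rowOffset p q i k ∧
      τ.reg .t = colOffset n p q i k ∧
      ∀ e < colOffset n p q i k, Rep τ.data .U e (outValue n p q x y i e) with hB
  refine Reaches.weaken (c₁ := 2 + ((8 + L * 1031) + (2 + (2 + ((1 + 1 + L * (1 + (6 * K + 40))) +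
      ((1 + 1 + colOffset n p q i L * (1 + K)) + 1)))))) ?_
    (Reaches.cons (Q' := fun τ => τ = σ.setReg .len 0) (Reaches.setReg rfl) fun τ hτ =>
    Reaches.cons (Q' := fun τ => Ready n p q x y Rep Inv i τ)
      ((matrixList_reaches H (i := i) ?_ hi ?_ ?_).mono le_rfl fun υ hυ => ?_) fun τ hτ =>
    Reaches.cons (Q' := fun τ => Ready n p q x y Rep Inv i τ ∧ τ.reg .s = 0)
      (Reaches.setReg ⟨hτ.setReg .s _, by simp⟩) fun τ hτ =>
    Reaches.cons (Q' := B 0)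
      (Reaches.setReg ⟨hτ.1.setReg .t _, ?_, ?_, ?_⟩) fun τ hτ =>
    Reaches.cons (Q' := _) (Reaches.loop (N := L) B ?_ hτ fun k hk τ hτ => ?_) fun τ hτ =>
    Reaches.cons (Q' := _) (Reaches.loop (N := colOffset n p q i L) (c := K)
      (fun c υ => HasInput n p q υ ∧ Inv υ.data ∧
        (∀ e < colOffset n p q i L, Rep υ.data .U e (outValue n p q x y i e)) ∧
        ∀ e < c, Rep υ.data .T e (outValue n p q x y i e)) ?_ ?_ fun c hc υ hυ => ?_) fun τ hτ =>
    Reaches.nil ?_)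
  · have e1 := Nat.mul_le_mul_right 1031 hL
    have e2 := Nat.mul_le_mul_right (1 + (6 * K + 40)) hL
    have e3 := Nat.mul_le_mul_right (1 + K) ht
    nlinarith
  · subst hτ
    exact hσ.input.setReg (by decide) _
  · subst hτ
    simp [hri]
  · subst hτ
    simp
  · subst hτ
    obtain ⟨h1, h2, h3, h4, h5⟩ := hυ
    refine ⟨h1, h2, h3, h5, ?_, ?_⟩
    · rw [h4]
      exact hσ.inv
    · rw [h4]
      exact hσ.rep
  · simp [hτ.2, rowOffset]
  · simp [colOffset]
  · simp [colOffset]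
  · simp [hτ.1.reg_len, hLdef]
  · obtain ⟨h1, h2, h3, h4⟩ := hτ
    exact hops.block_reaches H hi (by omega)
      ⟨h1.setReg .k k, by simp, by simp [h2], by simp [h3], h4⟩
  · simp [hτ.2.2.1]
  · exact ⟨hτ.1.input, hτ.1.inv, hτ.2.2.2, fun e he => absurd he (Nat.not_lt_zero _)⟩
  · obtain ⟨h1, h2, h3, h4⟩ := hυ
    refine (hops.copy (υ.setReg .c c) (outValue n p q x y i c)
      (h1.setReg (by decide) c).reg_n h2 (by simpa using h3 c hc)).mono le_rfl fun ω hω => ?_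
    obtain ⟨g1, g2, g3⟩ := hω
    simp only [Store.setReg_reg, if_true] at g3
    refine ⟨g1.hasInput (h1.setReg (by decide) c), g2,
      fun e he => g3.2 _ _ _ (Or.inl (by decide)) (h3 e he), fun e he => ?_⟩
    rcases Nat.lt_or_ge e c with h | h
    · exact g3.2 _ _ _ (Or.inr h.ne) (h4 e h)
    · obtain rfl : e = c := by omega
      exact g3.1
  · exact ⟨hτ.1, hτ.2.1, hτ.2.2.2⟩

theorem algorithm_reaches (H : IsRegionOfLength n p q) (hσ₀ : HasInput n p q σ₀) :
    Reaches (algorithm ops) σ₀ ((n + 1) ^ 2 * (10 * K + 1300)) fun τ =>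
      Rep τ.data .T 0 (pathSum n p q x y n (q n)) := by
  refine Reaches.weaken (c₁ := K + (K + ((3 + 1 + (n + 1) * (1 + (n + 1) * (8 * K + 1200))) + 1)))
    ?_ (Reaches.cons hops.init fun τ hτ =>
    Reaches.cons (Q' := AtStack n p q x y Rep Inv 0)
      ((hops.setOne τ (hτ.1.hasInput hσ₀).reg_n hτ.2).mono le_rfl fun υ hυ => ?_) fun υ hυ =>
    Reaches.cons (Q' := _) (Reaches.loop (N := n + 1) (AtStack n p q x y Rep Inv) ?_ hυ
      fun i hi τ hτ => hops.stack_reaches H (by omega)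
        ⟨hτ.input.setReg (by decide) _, hτ.inv, hτ.rep⟩ (by simp)) fun τ hτ => Reaches.nil ?_)
  · nlinarith [Nat.zero_le (n * K), Nat.zero_le (n * n * K), Nat.zero_le n, Nat.zero_le (n * n)]
  · obtain ⟨h1, h2, h3⟩ := hυ
    refine ⟨h1.hasInput (hτ.1.hasInput hσ₀), h2, fun e he => ?_⟩
    obtain rfl : e = 0 := by simpa [inSize] using he
    exact h3
  · simp [hυ.input.reg_n]
  · have e := hτ.rep 0 (by rw [inSize_succ H.toIsRegion]; omega)
    rw [inValue, outValue_top H] at e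
    exact e

end OpsSpec

end Algorithm

/-! ### The input memory -/

open LatticePath

theorem LatticePath.isRegionOfLength {m r : ℕ} {P Q : LatticePath m r} (h : NeverAbove P Q) :
    IsRegionOfLength (m + r) P.norths Q.norths where
  toIsRegion := isRegion h
  top := by rw [norths_of_le _ le_rfl, norths_of_le _ le_rfl]
  lower_succ_top := by rw [norths_of_le _ le_rfl, norths_of_le _ (Nat.le_succ _)]
  upper_succ_top := by rw [norths_of_le _ le_rfl, norths_of_le _ (Nat.le_succ _)]

theorem hasInput_inputStore {m r : ℕ} {R : Type*} [CommRing R] (P Q : LatticePath m r) (x y : R) :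
    HasInput (m + r) P.norths Q.norths (inputStore P Q x y) where
  reg_n := rfl
  arr_PN i hi := by simp [inputStore, hi]
  arr_QN i hi := by simp [inputStore, hi]
  arr_PE i hi := by
    have := P.easts_add_norths hi
    simp only [inputStore, hi, if_true]
    omega
  arr_QE i hi := by
    have := Q.easts_add_norths hi
    simp only [inputStore, hi, if_true]
    omega

/-! ## Operations on ring elements -/

section Scalar

variable {R : Type*} [CommRing R]

/-- The invariant protects the table `W` of the weights, in which `init` supplies the missing `W[0]
= 1`. Degrees play no role here. -/
theorem scalarOps_spec (n : ℕ) (x y : R) (σ₀ : Store Reg Arr Dat R)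
    (h1 : σ₀.data .W 1 = x) (h2 : σ₀.data .W 2 = y) :
    OpsSpec scalarOps n x y (fun data d e f => data d e = f)
      (fun data => data .W 0 = 1 ∧ data .W 1 = x ∧ data .W 2 = y) (fun _ _ => True) 40 σ₀ where
  small_one := trivial
  small_zero _ := trivial
  small_add _ _ _ _ _ := trivial
  small_mul _ _ _ _ := trivial
  small_mono _ _ _ _ _ := trivial
  init := by
    refine Reaches.weaken (by decide) (Reaches.setData ⟨⟨rfl, fun v _ => rfl⟩, ?_⟩)
    simp [DExp.eval, h1, h2]
  setOne σ _ hinv := by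
    refine Reaches.weaken (by decide) (Reaches.setData ⟨⟨rfl, fun v _ => rfl⟩, ?_, ?_⟩)
    · simpa using hinv
    · simp [DExp.eval]
  clear σ _ hinv := by
    refine Reaches.weaken (by decide) (Reaches.setData ⟨⟨rfl, fun v _ => rfl⟩, ?_, ?_, ?_⟩)
    · simpa using hinv
    · simp [DExp.eval]
    · rintro d e g hne rfl
      simp only [Store.setData_data, NExp.eval_add, NExp.eval_reg]
      rw [if_neg (by tauto)]
  addMul σ f g w _ hinv hg hf _ hw hw2 := by
    refine Reaches.weaken (by decide) (Reaches.setData ⟨⟨rfl, fun v _ => rfl⟩, ?_, ?_, ?_⟩)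
    · simpa using hinv
    · have hW : σ.data .W w = weight x y w := by
        unfold weight
        interval_cases w <;> simp [hinv]
      simp [DExp.eval, entryCell, hg, hf, hw, hW]
    · rintro d e g' hne rfl
      simp only [Store.setData_data, NExp.eval_add, NExp.eval_reg]
      rw [if_neg (by tauto)]
  copy σ f _ hinv hf := by
    refine Reaches.weaken (by decide) (Reaches.setData ⟨⟨rfl, fun v _ => rfl⟩, ?_, ?_, ?_⟩)
    · simpa using hinv
    · simp [DExp.eval, hf]
    · rintro d e g hne rfl
      simp only [Store.setData_data, NExp.eval_reg]
      rw [if_neg (by tauto)]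

theorem evalOutput_eq {m r : ℕ} {P Q : LatticePath m r} (h : NeverAbove P Q) (x y : R) :
    evalOutput P Q x y = pathSum (m + r) P.norths Q.norths x y (m + r) r ∧
      evalTime P Q x y ≤ (m + r + 1) ^ 2 * 1700 := by
  have key := (scalarOps_spec (m + r) x y (inputStore P Q x y) rfl rfl).algorithm_reaches
    (isRegionOfLength h) (hasInput_inputStore P Q x y)
  rw [norths_of_le Q le_rfl] at key
  exact key

end Scalar

/-! ## Operations on arrays of coefficients -/

section Poly

/-- The exponent of `x^u y^v`. -/
noncomputable def exponent (u v : ℕ) : Fin 2 →₀ ℕ := Finsupp.single 0 u + Finsupp.single 1 v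

theorem exponent_zero (u v : ℕ) : exponent u v 0 = u := by simp [exponent]

theorem exponent_one (u v : ℕ) : exponent u v 1 = v := by simp [exponent]

theorem eq_exponent_iff (s : Fin 2 →₀ ℕ) (u v : ℕ) : s = exponent u v ↔ s 0 = u ∧ s 1 = v := by
  constructor
  · rintro rfl
    exact ⟨exponent_zero u v, exponent_one u v⟩
  · rintro ⟨rfl, rfl⟩
    ext k
    fin_cases k <;> simp [exponent]

theorem coeff_mul_X_zero (f : MvPolynomial (Fin 2) ℤ) (u v : ℕ) :
    (f * MvPolynomial.X 0).coeff (exponent u v) =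
      if 1 ≤ u then f.coeff (exponent (u - 1) v) else 0 := by
  rw [MvPolynomial.coeff_mul_X']
  simp only [Finsupp.mem_support_iff, exponent_zero, ← Nat.one_le_iff_ne_zero]
  split_ifs
  · congr 1
    rw [eq_exponent_iff]
    simp [exponent]
  · rfl

theorem coeff_mul_X_one (f : MvPolynomial (Fin 2) ℤ) (u v : ℕ) :
    (f * MvPolynomial.X 1).coeff (exponent u v) =
      if 1 ≤ v then f.coeff (exponent u (v - 1)) else 0 := by
  rw [MvPolynomial.coeff_mul_X']
  simp only [Finsupp.mem_support_iff, exponent_one, ← Nat.one_le_iff_ne_zero]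
  split_ifs
  · congr 1
    rw [eq_exponent_iff]
    simp [exponent]
  · rfl

/-- Multiplication by a weight is a shift of the exponents, with the same shifts that the program
puts into `du` and `dv`. -/
theorem coeff_mul_weight (f : MvPolynomial (Fin 2) ℤ) (c u v : ℕ) :
    (f * weight (MvPolynomial.X 0) (MvPolynomial.X 1) c).coeff (exponent u v) =
      if (if c = 1 then 1 else 0) ≤ u ∧ (if c = 2 then 1 else 0) ≤ v then
        f.coeff (exponent (u - if c = 1 then 1 else 0) (v - if c = 2 then 1 else 0)) else 0 := by
  unfold weight
  by_cases h1 : c = 1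
  · subst h1
    simp [coeff_mul_X_zero]
  · by_cases h2 : c = 2
    · subst h2
      simp [coeff_mul_X_one]
    · simp [h1, h2]

/-- The coefficients of `f` in degrees above `i` in `x` or in `y` are zero. -/
def DegreesLe (i : ℕ) (f : MvPolynomial (Fin 2) ℤ) : Prop :=
  ∀ u v, i < u ∨ i < v → f.coeff (exponent u v) = 0

/-- The index of the coefficient of `x^u y^v` of entry `e`. -/
def cell (n e u v : ℕ) : ℕ := (e * (n + 2) + u) * (n + 2) + v

/-- Cells are numbers written in base `n + 2`, with the exponents as the last two digits. -/
theorem cell_inj {n e u v e' u' v' : ℕ} (hu : u < n + 2) (hv : v < n + 2) (hu' : u' < n + 2)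
    (hv' : v' < n + 2) : cell n e u v = cell n e' u' v' ↔ e = e' ∧ u = u' ∧ v = v' := by
  have key : ∀ a b c d : ℕ, b < n + 2 → d < n + 2 → a * (n + 2) + b = c * (n + 2) + d →
      a = c ∧ b = d := by
    intro a b c d hb hd h
    have h1 := congrArg (· / (n + 2)) h
    have h2 := congrArg (· % (n + 2)) h
    simp only [Nat.mul_add_mod', Nat.mod_eq_of_lt hb, Nat.mod_eq_of_lt hd] at h2
    subst h2
    exact ⟨Nat.eq_of_mul_eq_mul_right (by omega : 0 < n + 2) (by omega), rfl⟩
  constructor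
  · intro h
    obtain ⟨h1, rfl⟩ := key _ _ _ _ hv hv' h
    obtain ⟨rfl, rfl⟩ := key _ _ _ _ hu hu' h1
    exact ⟨rfl, rfl, rfl⟩
  · rintro ⟨rfl, rfl, rfl⟩
    rfl

/-- Entry `e` of `d` is the array of the coefficients of `f`. -/
def IsCoeffArray (n : ℕ) (data : Dat → ℕ → ℤ) (d : Dat) (e : ℕ) (f : MvPolynomial (Fin 2) ℤ) :
    Prop :=
  ∀ u v, u < n + 2 → v < n + 2 → data d (cell n e u v) = f.coeff (exponent u v)

/-- The memories agree except for `d` and for the registers `u` and `v`. -/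
structure AgreeOff (d : Dat) (σ τ : Store Reg Arr Dat ℤ) : Prop where
  arr : τ.arr = σ.arr
  reg : ∀ w, w ≠ .u → w ≠ .v → τ.reg w = σ.reg w
  data : ∀ d', d' ≠ d → τ.data d' = σ.data d'

/-- A loop over the coefficients of an entry, with a shift of the exponents by `a` and `b`. -/
theorem coeffLoop_reaches {n N E a b : ℕ} {σ : Store Reg Arr Dat ℤ} {d : Dat} {eN ce : NE}
    {te : DExp Reg Arr Dat} (G : ℕ → ℕ → ℤ → ℤ) (ha : N + a ≤ n + 2) (hb : N + b ≤ n + 2)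
    (hN : ∀ τ, AgreeOff d σ τ → eN.eval τ = N)
    (hce : ∀ τ, AgreeOff d σ τ → ce.eval τ = cell n E (τ.reg .u + a) (τ.reg .v + b))
    (hte : ∀ τ, AgreeOff d σ τ → te.eval τ =
      G (τ.reg .u) (τ.reg .v) (τ.data d (cell n E (τ.reg .u + a) (τ.reg .v + b)))) :
    Reaches (.loop .u eN (.loop .v eN (.setData d ce te)) : Prog) σ
      (eN.cost + 1 + N * (1 + (eN.cost + 1 + N * (1 + (ce.cost + te.cost + 1))))) fun τ =>
      AgreeOff d σ τ ∧ ∀ e u v, u < n + 2 → v < n + 2 → τ.data d (cell n e u v) =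
        if e = E ∧ (a ≤ u ∧ u < a + N) ∧ b ≤ v ∧ v < b + N then
          G (u - a) (v - b) (σ.data d (cell n e u v)) else σ.data d (cell n e u v) := by
  -- The cells that come before `(k, l)` in the lexicographic order of the loop counters are done,
  -- and all others are untouched. Hence each cell still holds its old value when `G` reads it.
  set I : ℕ → ℕ → Store Reg Arr Dat ℤ → Prop := fun k l τ =>
    AgreeOff d σ τ ∧ ∀ e u v, u < n + 2 → v < n + 2 → τ.data d (cell n e u v) =
      if e = E ∧ a ≤ u ∧ (b ≤ v ∧ v < b + N) ∧ (u < a + k ∨ u = a + k ∧ v < b + l) then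
        G (u - a) (v - b) (σ.data d (cell n e u v)) else σ.data d (cell n e u v) with hI
  have hreg : ∀ τ w z, w = .u ∨ w = .v → AgreeOff d σ τ → AgreeOff d σ (τ.setReg w z) := by
    intro τ w z hw h
    refine ⟨h.arr, fun w' h1 h2 => ?_, h.data⟩
    have : w' ≠ w := by rcases hw with rfl | rfl <;> assumption
    simp [this, h.reg w' h1 h2]
  refine (Reaches.loop (N := N) (fun k => I k 0) (hN σ ⟨rfl, fun _ _ _ => rfl, fun _ _ => rfl⟩)
    ⟨⟨rfl, fun _ _ _ => rfl, fun _ _ => rfl⟩, fun e u v hu hv => ?_⟩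
    fun k hk τ hτ => (Reaches.loop (N := N) (fun l τ => I k l τ ∧ τ.reg .u = k)
      (hN _ (hreg _ _ _ (Or.inl rfl) hτ.1)) ⟨⟨hreg _ _ _ (Or.inl rfl) hτ.1, hτ.2⟩, by simp⟩
      fun l hl τ hτ => Reaches.setData ?_).mono le_rfl fun τ hτ => ?_).mono le_rfl fun τ hτ => ?_
  · rw [if_neg (by omega)]
  · obtain ⟨⟨h1, h2⟩, h3⟩ := hτ
    have h1' := hreg _ .v l (Or.inr rfl) h1
    rw [hce _ h1', hte _ h1']
    simp only [Store.setReg_reg, reduceCtorEq, if_false, if_true, h3, Store.setReg_data]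
    refine ⟨⟨⟨h1.arr, fun w hw hw' => ?_, fun d' hd' => ?_⟩, fun e u v hu hv => ?_⟩, ?_⟩
    · simp [hw', h1.reg w hw hw']
    · funext j
      simp [hd', h1.data d' hd']
    · simp only [Store.setData_data, true_and, Store.setReg_data]
      have hiff : cell n e u v = cell n E (k + a) (l + b) ↔ _ :=
        cell_inj hu hv (by omega) (by omega)
      by_cases hc : e = E ∧ u = k + a ∧ v = l + b
      · obtain ⟨rfl, rfl, rfl⟩ := hc
        rw [if_pos rfl, h2 e _ _ hu hv, if_neg (by omega), if_pos ⟨rfl, by omega⟩,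
          Nat.add_sub_cancel, Nat.add_sub_cancel]
      · rw [if_neg (mt hiff.1 hc), h2 e u v hu hv]
        refine if_congr ?_ rfl rfl
        omega
    · simp [h3]
  · obtain ⟨⟨h1, h2⟩, -⟩ := hτ
    refine ⟨h1, fun e u v hu hv => ?_⟩
    rw [h2 e u v hu hv]
    refine if_congr ?_ rfl rfl
    omega
  · obtain ⟨h1, h2⟩ := hτ
    refine ⟨h1, fun e u v hu hv => ?_⟩
    rw [h2 e u v hu hv]
    refine if_congr ?_ rfl rfl
    omega

theorem AgreeOff.sameControl {d : Dat} {σ τ : Store Reg Arr Dat ℤ} (h : AgreeOff d σ τ) :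
    SameControl σ τ :=
  ⟨h.arr, fun w hw => by
    simp only [List.mem_cons, List.not_mem_nil, or_false, not_or] at hw
    exact h.reg w hw.1 hw.2.1⟩

theorem AgreeOff.writes {n E : ℕ} {d : Dat} {f : MvPolynomial (Fin 2) ℤ}
    {σ τ : Store Reg Arr Dat ℤ} (h : AgreeOff d σ τ) (hf : IsCoeffArray n τ.data d E f)
    (hE : ∀ e u v, u < n + 2 → v < n + 2 → e ≠ E →
      τ.data d (cell n e u v) = σ.data d (cell n e u v)) :
    Writes (IsCoeffArray n) d E f σ τ := by
  refine ⟨hf, fun d' e' g hne hg u v hu hv => ?_⟩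
  by_cases hd : d' = d
  · subst hd
    rw [hE e' u v hu hv (by tauto)]
    exact hg u v hu hv
  · rw [h.data d' hd]
    exact hg u v hu hv

/-- The expression does not depend on the loop counters `u` and `v`. -/
def IsConstant (e : NE) (k : ℕ) (σ : Store Reg Arr Dat ℤ) : Prop :=
  ∀ d τ, AgreeOff d σ τ → e.eval τ = k

theorem clearPoly_reaches {n E : ℕ} {σ : Store Reg Arr Dat ℤ} (hn : σ.reg .n = n) (d : Dat)
    {e : NE} (he : IsConstant e E σ) (hcost : e.cost ≤ 3) :
    Reaches (clearPoly d e) σ (40 * (n + 2) ^ 2) fun τ =>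
      AgreeOff d σ τ ∧ Writes (IsCoeffArray n) d E 0 σ τ := by
  refine (coeffLoop_reaches (n := n) (N := n + 2) (E := E) (a := 0) (b := 0) (fun _ _ _ => 0)
    le_rfl le_rfl (fun τ hτ => ?_) (fun τ hτ => ?_) fun τ hτ => rfl).mono ?_ fun τ hτ =>
    ⟨hτ.1, hτ.1.writes (fun u v hu hv => ?_) fun e' u v hu hv hne => ?_⟩
  · simp [hτ.reg .n, hn]
  · simp [coeffCell, cell, he d τ hτ, hτ.reg .n, hn]
  · simp only [coeffCell, NExp.cost_add, NExp.cost_mul, NExp.cost_reg, NExp.cost_ofNat, DExp.cost]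
    nlinarith
  · rw [hτ.2 E u v hu hv, if_pos ⟨rfl, by omega⟩]
    simp
  · rw [hτ.2 e' u v hu hv, if_neg (by tauto)]

/-- A factor of degree at most `n` fits into the loops up to `n`, and its shift by one still fits
into exponents below `n + 2`. -/
theorem polyOps_spec (n : ℕ) (σ₀ : Store Reg Arr Dat ℤ) :
    OpsSpec polyOps n (MvPolynomial.X 0) (MvPolynomial.X 1) (IsCoeffArray n) (fun _ => True)
      DegreesLe (200 * (n + 2) ^ 2) σ₀ where
  small_one := by
    intro u v huv
    rw [MvPolynomial.coeff_one, if_neg]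
    intro h
    rw [eq_exponent_iff] at h
    simp at h
    omega
  small_zero i u v huv := by simp
  small_add i f g hf hg u v huv := by simp [hf u v huv, hg u v huv]
  small_mul i f c hf u v huv := by
    rw [coeff_mul_weight]
    split_ifs <;> first | rfl | exact hf _ _ (by omega)
  small_mono i j f hij hf u v huv := hf u v (by omega)
  init := Reaches.weaken (Nat.succ_le_of_lt (by positivity)) (Reaches.skip ⟨⟨rfl, fun _ _ => rfl⟩, trivial⟩)
  setOne σ hn _ := by
    refine Reaches.weaken ?_ (Reaches.cons (clearPoly_reaches (E := 0) hn .T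
      (fun d τ _ => by simp) (by decide)) fun τ hτ => Reaches.cons (c₁ := 20) (c₂ := 1)
      (Q' := _) (Reaches.weaken (by decide) (Reaches.setData ?_)) fun υ hυ => Reaches.nil hυ)
    · nlinarith
    · refine ⟨hτ.1.sameControl, trivial, fun u v hu hv => ?_⟩
      have hcell : (coeffCell 0 0 0).eval τ = cell n 0 0 0 := by simp [coeffCell, cell]
      simp only [hcell, Store.setData_data, true_and, DExp.eval]
      have hiff : cell n 0 u v = cell n 0 0 0 ↔ _ := cell_inj hu hv (by omega) (by omega)
      by_cases hc : u = 0 ∧ v = 0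
      · obtain ⟨rfl, rfl⟩ := hc
        rw [if_pos rfl, MvPolynomial.coeff_one, if_pos]
        rw [eq_exponent_iff]
        simp
      · rw [if_neg (fun h => hc (hiff.1 h).2), hτ.2.1 u v hu hv, MvPolynomial.coeff_one, if_neg]
        · simp
        · rw [eq_exponent_iff]
          simpa [eq_comm] using hc
  clear σ hn _ := (clearPoly_reaches (E := σ.reg .t + σ.reg .c) hn .U
    (fun d τ hτ => by simp [hτ.reg]) (by decide)).mono (by nlinarith) fun τ hτ =>
    ⟨hτ.1.sameControl, trivial, hτ.2⟩
  addMul σ f g w hn _ hg hf hdeg hw hw2 := by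
    set E₁ := σ.reg .t + σ.reg .c with hE₁
    set E₂ := σ.reg .s + σ.reg .p with hE₂
    set a := if w = 1 then 1 else 0 with ha
    set b := if w = 2 then 1 else 0 with hb
    have ha1 : a ≤ 1 := by split_ifs at ha <;> omega
    have hb1 : b ≤ 1 := by split_ifs at hb <;> omega
    have hwe : ∀ τ : Store Reg Arr Dat ℤ, τ.arr = σ.arr → τ.reg .k = σ.reg .k →
        τ.reg .p = σ.reg .p → τ.reg .c = σ.reg .c →
        (NExp.get Arr.entry (entryCell Reg.k Reg.p Reg.c)).eval τ = w := by
      intro τ h1 h2 h3 h4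
      simp [entryCell, h1, h2, h3, h4, hw]
    refine Reaches.weaken ?_ (Reaches.cons (c₁ := 30) (Q' := fun τ => τ = σ.setReg .du a)
      (Reaches.weaken ?_ (Reaches.ite (c₁ := 2) (c₂ := 2) (fun h => Reaches.setReg ?_)
        fun h => Reaches.setReg ?_)) fun τ hτ =>
      Reaches.cons (c₁ := 30) (Q' := fun τ => τ = (σ.setReg .du a).setReg .dv b)
      (Reaches.weaken ?_ (Reaches.ite (c₁ := 2) (c₂ := 2) (fun h => Reaches.setReg ?_)
        fun h => Reaches.setReg ?_)) fun τ hτ =>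
      Reaches.cons (c₂ := 1) (Q' := fun υ => SameControl σ υ ∧ True ∧
        Writes (IsCoeffArray n) Dat.U E₁
          (g + f * weight (MvPolynomial.X 0) (MvPolynomial.X 1) w) σ υ)
      ((coeffLoop_reaches (n := n) (N := n + 1) (E := E₁) (a := a) (b := b) (fun u v z =>
        z + σ.data .T (cell n E₂ u v)) (by omega) (by omega) (fun υ hυ => ?_) (fun υ hυ => ?_)
        fun υ hυ => ?_).mono le_rfl fun υ hυ => ?_)
      fun τ hτ => Reaches.nil hτ)
    · simp only [coeffCell, NExp.cost_add, NExp.cost_mul, NExp.cost_reg, NExp.cost_ofNat,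
        DExp.cost]
      nlinarith
    · decide
    · simp only [BExp.eval, hwe σ rfl rfl rfl rfl, NExp.eval_ofNat, decide_eq_true_eq] at h
      simp [ha, h]
    · simp only [BExp.eval, hwe σ rfl rfl rfl rfl, NExp.eval_ofNat, decide_eq_false_iff_not] at h
      simp [ha, h]
    · decide
    · subst hτ
      rw [BExp.eval, hwe (σ.setReg .du a) rfl (by simp) (by simp) (by simp), NExp.eval_ofNat,
        decide_eq_true_eq] at h
      simp [hb, h]
    · subst hτ
      rw [BExp.eval, hwe (σ.setReg .du a) rfl (by simp) (by simp) (by simp), NExp.eval_ofNat,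
        decide_eq_false_iff_not] at h
      simp [hb, h]
    · subst hτ
      simp [hυ.reg .n, hn]
    · subst hτ
      simp [coeffCell, cell, hυ.reg, hn, hE₁]
    · subst hτ
      simp [DExp.eval, coeffCell, cell, hυ.reg, hυ.data .T, hn, hE₁, hE₂]
    · subst hτ
      obtain ⟨h1, h2⟩ := hυ
      have h1s : SameControl σ υ := by
        refine ⟨h1.arr, fun v hv => ?_⟩
        simp only [List.mem_cons, List.not_mem_nil, or_false, not_or] at hv
        rw [h1.reg v hv.1 hv.2.1]
        simp [hv]
      have h1d : ∀ d', d' ≠ .U → υ.data d' = σ.data d' := h1.data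
      simp only [Store.setReg_data] at h2
      refine ⟨h1s, trivial, fun u v hu hv => ?_, fun d' e' g' hne hg' u v hu hv => ?_⟩
      · rw [h2 E₁ u v hu hv, hg u v hu hv, MvPolynomial.coeff_add, coeff_mul_weight, ← ha, ← hb]
        by_cases hc : a ≤ u ∧ b ≤ v
        · rw [if_pos hc]
          by_cases hc' : u < a + (n + 1) ∧ v < b + (n + 1)
          · rw [if_pos ⟨rfl, by omega⟩, hf _ _ (by omega) (by omega)]
          -- Such a cell is not reached by the loops, but the coefficient of `f` that belongs to it
          -- has an exponent above `n` and vanishes.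
          · rw [if_neg (by omega), hdeg _ _ (by omega), add_zero]
        · rw [if_neg hc, if_neg (by omega), add_zero]
      · by_cases hd : d' = .U
        · subst hd
          rw [h2 e' u v hu hv, if_neg (by tauto)]
          exact hg' u v hu hv
        · rw [h1d d' hd]
          exact hg' u v hu hv
  copy σ f hn _ hf := by
    refine (coeffLoop_reaches (n := n) (N := n + 2) (E := σ.reg .c) (a := 0) (b := 0)
      (fun u v _ => σ.data .U (cell n (σ.reg .c) u v))
      le_rfl le_rfl (fun τ hτ => ?_) (fun τ hτ => ?_) fun τ hτ => ?_).mono ?_ fun τ hτ =>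
      ⟨hτ.1.sameControl, trivial, hτ.1.writes (fun u v hu hv => ?_) fun e' u v hu hv hne => ?_⟩
    · simp [hτ.reg .n, hn]
    · simp [coeffCell, cell, hτ.reg, hn]
    · simp [DExp.eval, coeffCell, cell, hτ.reg, hτ.data .U, hn]
    · simp only [coeffCell, NExp.cost_add, NExp.cost_mul, NExp.cost_reg, NExp.cost_ofNat,
        DExp.cost]
      nlinarith
    · rw [hτ.2 _ u v hu hv, if_pos ⟨rfl, by omega⟩]
      exact hf u v hu hv
    · rw [hτ.2 e' u v hu hv, if_neg (by tauto)]

/-- The array records only exponents below `n + 2`; the degree bound shows that nothing lies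
outside. -/
theorem sum_coeffArray {n : ℕ} {data : Dat → ℕ → ℤ} {f : MvPolynomial (Fin 2) ℤ}
    (hf : IsCoeffArray n data .T 0 f) (hdeg : DegreesLe n f) :
    ∑ k ∈ Finset.range (n + 2), ∑ l ∈ Finset.range (n + 2),
      MvPolynomial.C (data .T (k * (n + 2) + l)) * MvPolynomial.X 0 ^ k *
        MvPolynomial.X 1 ^ l = f := by
  have hterm : ∀ k l : ℕ, ∀ z : ℤ, (MvPolynomial.C z * MvPolynomial.X 0 ^ k *
      MvPolynomial.X 1 ^ l : MvPolynomial (Fin 2) ℤ) = MvPolynomial.monomial (exponent k l) z := by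
    intro k l z
    rw [MvPolynomial.X_pow_eq_monomial, MvPolynomial.X_pow_eq_monomial,
      MvPolynomial.C_mul_monomial, MvPolynomial.monomial_mul, mul_one, mul_one, exponent]
  ext s
  obtain ⟨u, v, rfl⟩ : ∃ u v, s = exponent u v := ⟨s 0, s 1, by rw [eq_exponent_iff]; simp⟩
  simp only [hterm, MvPolynomial.coeff_sum, MvPolynomial.coeff_monomial]
  have hc : ∀ k l, exponent k l = exponent u v ↔ k = u ∧ l = v := fun k l => by
    rw [eq_exponent_iff, exponent_zero, exponent_one]
  simp only [hc, ite_and]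
  by_cases huv : u < n + 2 ∧ v < n + 2
  · have := hf u v huv.1 huv.2
    rw [cell, zero_mul, zero_add] at this
    simp [huv, this]
  · rw [hdeg u v (by omega)]
    refine Finset.sum_eq_zero fun k hk => Finset.sum_eq_zero fun l hl => ?_
    rw [Finset.mem_range] at hk hl
    split_ifs <;> first | rfl | omega

theorem polyOutput_eq {m r : ℕ} {P Q : LatticePath m r} (h : NeverAbove P Q) :
    polyOutput P Q = pathSum (m + r) P.norths Q.norths (MvPolynomial.X 0) (MvPolynomial.X 1)
      (m + r) r ∧
      polyTime P Q ≤ (m + r + 1) ^ 2 * (10 * (200 * (m + r + 2) ^ 2) + 1300) := by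
  have spec := polyOps_spec (m + r) (inputStore P Q (0 : ℤ) 0)
  have key := spec.algorithm_reaches (isRegionOfLength h) (hasInput_inputStore P Q (0 : ℤ) 0)
  rw [norths_of_le Q le_rfl] at key
  exact ⟨sum_coeffArray key.1 (spec.small_pathSum _ _), key.2⟩

end Poly

end LatticeTutte

/-! ### The main theorem -/

theorem theorem1 :
    -- for indeterminate `x` and `y`: correctness, and `O(n⁴)` time
    (∃ C : ℕ, ∀ (m r : ℕ) (P Q : LatticeTutte.LatticePath m r)
      (h : LatticeTutte.LatticePath.NeverAbove P Q),
      LatticeTutte.polyOutput P Q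
          = LatticeTutte.tuttePolynomial (LatticeTutte.latticePathMatroid P Q h) ∧
        (∀ {α : Type*} (N : Matroid α), LatticeTutte.IsIsomorphicTo N P Q h →
          LatticeTutte.polyOutput P Q = LatticeTutte.tuttePolynomial N) ∧
        (1 ≤ m + r → LatticeTutte.polyTime P Q ≤ C * (m + r) ^ 4)) ∧
    -- for fixed values of `x` and `y`: correctness, and `O(n²)` operations
    (∃ C : ℕ, ∀ (R : Type*) [CommRing R] (x y : R) (m r : ℕ) (P Q : LatticeTutte.LatticePath m r)
      (h : LatticeTutte.LatticePath.NeverAbove P Q),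
      LatticeTutte.evalOutput P Q x y = MvPolynomial.aeval ![x, y]
          (LatticeTutte.tuttePolynomial (LatticeTutte.latticePathMatroid P Q h)) ∧
        (∀ {α : Type*} (N : Matroid α), LatticeTutte.IsIsomorphicTo N P Q h →
          LatticeTutte.evalOutput P Q x y
            = MvPolynomial.aeval ![x, y] (LatticeTutte.tuttePolynomial N)) ∧
        (1 ≤ m + r → LatticeTutte.evalTime P Q x y ≤ C * (m + r) ^ 2)) := by
  constructor
  -- With `n + 1 ≤ 2 n` and `n + 2 ≤ 3 n` for `n ≥ 1`, the constant is `4 * (2000 * 9 + 1300)`.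
  · refine ⟨77200, fun m r P Q h => ?_⟩
    obtain ⟨h₁, h₂⟩ := LatticeTutte.polyOutput_eq h
    rw [← LatticeTutte.tuttePolynomial_latticePathMatroid h] at h₁
    refine ⟨h₁, ?_, fun hn => h₂.trans ?_⟩
    · rintro α _ ⟨f, rfl⟩
      rw [h₁, LatticeTutte.tuttePolynomial_mapEmbedding]
    · have e₁ : (m + r + 1) ^ 2 ≤ (2 * (m + r)) ^ 2 := Nat.pow_le_pow_left (by omega) 2
      have e₂ : (m + r + 2) ^ 2 ≤ (3 * (m + r)) ^ 2 := Nat.pow_le_pow_left (by omega) 2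
      have e₃ : 1 ≤ (m + r) ^ 2 := Nat.one_le_pow _ _ hn
      calc (m + r + 1) ^ 2 * (10 * (200 * (m + r + 2) ^ 2) + 1300)
          ≤ (2 * (m + r)) ^ 2 *
            (10 * (200 * (3 * (m + r)) ^ 2) + 1300 * (m + r) ^ 2) :=
            Nat.mul_le_mul e₁ (by omega)
        _ = 77200 * (m + r) ^ 4 := by ring
  -- The constant is `4 * 1700`, again from `n + 1 ≤ 2 n`.
  · refine ⟨6800, fun R _ x y m r P Q h => ?_⟩
    obtain ⟨h₁, h₂⟩ := LatticeTutte.evalOutput_eq h x y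
    rw [← LatticeTutte.aeval_tuttePolynomial_latticePathMatroid h] at h₁
    refine ⟨h₁, ?_, fun hn => h₂.trans ?_⟩
    · rintro α _ ⟨f, rfl⟩
      rw [h₁, LatticeTutte.tuttePolynomial_mapEmbedding]
    · have e₁ : (m + r + 1) ^ 2 ≤ (2 * (m + r)) ^ 2 := Nat.pow_le_pow_left (by omega) 2
      calc (m + r + 1) ^ 2 * 1700 ≤ (2 * (m + r)) ^ 2 * 1700 := Nat.mul_le_mul_right _ e₁
        _ = 6800 * (m + r) ^ 2 := by ring
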